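/- Let $d\ge 1$ and $p\in(0,1]$. Let each site of $\mathbb{Z}^d$ be occupied with probability $p$, independently of all others, and, independently of this, let each site $v$ be given a direction chosen uniformly at random from $\{\pm e_1,\dots,\pm e_d\}$, independently for different sites; write $\mathbb{P}_p$ for the resulting (product) probability measure. A pair of distinct occupied sites that differ in exactly one coordinate is called feasible if there is no other occupied site on the straight line-segment of $\mathbb{Z}^d$ joining them. The segment joining a feasible pair $u,v$ is blue if $v$ lies in the chosen direction from $u$ or $u$ lies in the chosen direction from $v$. A nearest-neighbour edge of $\mathbb{Z}^d$ is blue if it lies in a blue segment. Let $N\in\{0,1,2,\dots\}\cup\{\infty\}$ be the number of infinite blue clusters, that is, of infinite connected components of the graph with vertex set $\mathbb{Z}^d$ formed by the blue edges (the one-choice model). Then either $\mathbb{P}_p(N=0)=1$ or $\mathbb{P}_p(N=1)=1$. -/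

import Mathlib

open MeasureTheory ProbabilityTheory

noncomputable section

namespace OneChoice

/-- The sites of the hypercubic lattice `ℤ^d`. -/
abbrev Site (d : ℕ) : Type := Fin d → ℤ

/-- The `2d` coordinate directions `± e_i`: `(i, true)` stands for `e_i` and `(i, false)`
for `-e_i`. -/
abbrev Direction (d : ℕ) : Type := Fin d × Bool

/-- The unit vector of a coordinate direction. -/
def Direction.vec {d : ℕ} (a : Direction d) : Site d :=
  Pi.single a.1 (if a.2 then 1 else -1)

/-- A site configuration; `v` is occupied if `ω v = true`. -/
abbrev SiteConfig (d : ℕ) : Type := Site d → Bool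

/-- An assignment of a chosen direction to every site. -/
abbrev DirConfig (d : ℕ) : Type := Site d → Direction d

/-- Site percolation: product measure on `{0,1}^{ℤ^d}` with density `p`. -/
def siteMeasure (d : ℕ) (p : unitInterval) : Measure (SiteConfig d) :=
  Measure.infinitePi fun _ : Site d => bernoulliMeasure true false p

/-- The directions are independent and uniform on the `2d` coordinate directions. -/
def dirMeasure (d : ℕ) [NeZero d] : Measure (DirConfig d) :=
  Measure.infinitePi fun _ : Site d => (PMF.uniformOfFintype (Direction d)).toMeasure

/-- The law of the one-choice model with density `p`: occupied sites and chosen directions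
are independent. -/
def oneChoiceMeasure (d : ℕ) [NeZero d] (p : unitInterval) :
    Measure (SiteConfig d × DirConfig d) :=
  (siteMeasure d p).prod (dirMeasure d)

/-- `u`, `v` form a feasible pair: they are occupied, differ in exactly one coordinate, and are
the only occupied sites on the straight line-segment joining them. (For sites differing in exactly
one coordinate, the sites of that segment are those of the order interval `Set.uIcc u v`.) -/
def Feasible {d : ℕ} (ω : SiteConfig d) (u v : Site d) : Prop :=
  ω u = true ∧ ω v = true ∧ (∃! i, u i ≠ v i) ∧
    ∀ w ∈ Set.uIcc u v, ω w = true → w = u ∨ w = v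

/-- The site `u` declares the segment joining `u` and `v` to be green: the pair is feasible and
`v` lies in the chosen direction of `u`. -/
def Declares {d : ℕ} (ω : SiteConfig d) (δ : DirConfig d) (u v : Site d) : Prop :=
  Feasible ω u v ∧ ∃ n : ℕ, v = u + n • (δ u).vec

/-- A segment is blue if at least one of its endvertices has declared it green. -/
def BlueSegment {d : ℕ} (ω : SiteConfig d) (δ : DirConfig d) (u v : Site d) : Prop :=
  Declares ω δ u v ∨ Declares ω δ v u

/-- The graph on `ℤ^d` of the blue edges: the nearest-neighbour edges that lie in a blue
segment. -/
def blueGraph {d : ℕ} (ω : SiteConfig d) (δ : DirConfig d) : SimpleGraph (Site d) where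
  Adj x y := ∑ i, |x i - y i| = 1 ∧
    ∃ u v, BlueSegment ω δ u v ∧ x ∈ Set.uIcc u v ∧ y ∈ Set.uIcc u v
  symm := ⟨by
    rintro x y ⟨h, u, v, hb, hx, hy⟩
    exact ⟨by simpa only [abs_sub_comm] using h, u, v, hb, hy, hx⟩⟩
  loopless := ⟨by
    rintro x ⟨h, -⟩
    simp at h⟩

/-- The number (possibly `∞`) of infinite blue clusters, i.e. of infinite connected components of
the graph of blue edges. -/
def numInfiniteClusters {d : ℕ} (ω : SiteConfig d) (δ : DirConfig d) : ℕ∞ :=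
  {C : (blueGraph ω δ).ConnectedComponent | C.supp.Infinite}.encard

end OneChoice

end

/-! The proof follows Burton and Keane. Translations are ergodic (`ergodic_shiftConfig`), so "some
infinite cluster" and "at least two infinite clusters" each have probability 0 or 1, and only the
second being almost sure has to be excluded. If it were, a finite modification of the directions
would produce a trifurcation: a finite connected set whose removal leaves three distinct infinite
branches in its cluster. But trifurcations are null (`measure_trifurcation_eq_zero`): disjoint
trifurcations in a box are at most as many as its boundary sites (`card_trifurcations_le`), while
their expected number would grow like the volume.

The obstacle is the local modification. Every direction has positive probability, so almost sure
statements survive finite changes of directions (`ae_forall_finite_modification`); yet redirecting a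
site towards a new neighbour may destroy the segment it declared before. The remedy rests on the map
sending an occupied site to the site it declares. Almost surely its orbits are eventually periodic
(`ae_eventuallyPeriodic`), because each fresh site points back to its predecessor with probability
1/(2d). Reversing arrows along the orbit of c keeps all its segments but at most one, which can be
chosen on the terminal cycle, and leaves the direction of c free (`exists_freeing`).

Occupied sites are almost surely linked by chains of feasible pairs
(`Crossing.reflTransGen_feasible`). Following such a chain from one infinite cluster to another and
turning each newly met site back towards the chain glues clusters together (`exists_furcates_succ`).
A modification may split an infinite cluster, so the induction tracks the stable notion `Furcates`:
the number of infinite pieces left after some finite deletion. One gluing raises it by one; two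
gluings lead from 1 to 3. -/

/-! ### Finite perturbations of graphs, furcations and trifurcations. -/

namespace SimpleGraph

variable {V : Type*}

/-- Every edge of exactly one of the two graphs has both endpoints in `W`. -/
def AgreeOff (W : Set V) (G H : SimpleGraph V) : Prop :=
  ∀ u v, ¬(G.Adj u v ↔ H.Adj u v) → u ∈ W ∧ v ∈ W

/-- The vertices reachable from `x`. -/
def comp (G : SimpleGraph V) (x : V) : Set V := {v | G.Reachable x v}

theorem mem_comp {G : SimpleGraph V} {x v : V} : v ∈ G.comp x ↔ G.Reachable x v := Iff.rfl

theorem Reachable.comp_eq {G : SimpleGraph V} {x y : V} (h : G.Reachable x y) :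
    G.comp x = G.comp y := by
  ext v
  exact ⟨fun hv => h.symm.trans hv, fun hv => h.trans hv⟩

/-- Deleting edges inside a set splits a connected component into pieces meeting that set. -/
theorem Reachable.reachable_or_exists_mem {G H : SimpleGraph V} {W : Set V}
    (h : ∀ u v, G.Adj u v → ¬H.Adj u v → v ∈ W) {x v : V} (hv : G.Reachable x v) :
    H.Reachable x v ∨ ∃ z ∈ W, G.Reachable x z ∧ H.Reachable z v := by
  rw [reachable_iff_reflTransGen] at hv
  induction hv with
  | refl => exact Or.inl (Reachable.refl _)
  | @tail b c hb hbc ih =>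
    by_cases hH : H.Adj b c
    · rcases ih with ih | ⟨z, hz, hz1, hz2⟩
      · exact Or.inl (ih.trans hH.reachable)
      · exact Or.inr ⟨z, hz, hz1, hz2.trans hH.reachable⟩
    · exact Or.inr ⟨c, h _ _ hbc hH,
        ((reachable_iff_reflTransGen _ _).2 hb).trans hbc.reachable, Reachable.refl _⟩

/-- Deleting finitely many edges from an infinite component leaves an infinite component. -/
theorem exists_infinite_comp {G H : SimpleGraph V} {W : Set V} (hW : W.Finite)
    (h : ∀ u v, G.Adj u v → ¬H.Adj u v → v ∈ W) {x : V} (hx : (G.comp x).Infinite) :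
    ∃ z ∈ insert x W, G.Reachable x z ∧ (H.comp z).Infinite := by
  by_contra! hcon
  apply hx
  -- These finitely many pieces cover the component of `x`; were all of them finite, so would it be.
  have hfin : (⋃ z ∈ insert x W ∩ G.comp x, H.comp z).Finite := by
    apply Set.Finite.biUnion ((hW.insert x).inter_of_left _)
    intro z hz
    by_contra hinf
    exact hinf (hcon z hz.1 hz.2)
  refine hfin.subset ?_
  intro v hv
  simp only [Set.mem_iUnion]
  rcases Reachable.reachable_or_exists_mem h hv with h1 | ⟨z, hz, h1, h2⟩
  · exact ⟨x, ⟨Set.mem_insert _ _, Reachable.refl _⟩, h1⟩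
  · exact ⟨z, ⟨Set.mem_insert_of_mem _ hz, h1⟩, h2⟩

/-- After deleting finitely many edges, the component of `x` contains at least `k` distinct
infinite components. -/
def Furcates (G : SimpleGraph V) (k : ℕ) (x : V) : Prop :=
  ∃ H ≤ G, ∃ W : Set V, W.Finite ∧ (∀ u v, G.Adj u v → ¬H.Adj u v → u ∈ W ∧ v ∈ W) ∧
    ∃ y : Fin k → V, (∀ i, G.Reachable x (y i)) ∧ (∀ i, (H.comp (y i)).Infinite) ∧
      ∀ i j, i ≠ j → ¬H.Reachable (y i) (y j)

theorem furcates_one {G : SimpleGraph V} {x : V} (hx : (G.comp x).Infinite) :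
    G.Furcates 1 x :=
  ⟨G, le_rfl, ∅, Set.finite_empty, fun _ _ h h' => absurd h h', fun _ => x,
    fun _ => Reachable.refl _, fun _ => hx, fun i j hij => absurd (Subsingleton.elim i j) hij⟩

theorem Furcates.infinite {G : SimpleGraph V} {k : ℕ} {x : V} (h : G.Furcates (k + 1) x) :
    (G.comp x).Infinite := by
  obtain ⟨H, hH, W, -, -, y, hy, hy', -⟩ := h
  exact (hy' 0).mono fun v hv => (hy 0).trans (Reachable.mono hH hv)

/-- An edge of `A` absent from `H ⊓ G'` was either deleted in passing to `H` or altered in passing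
to `G'`, so it ends in `W ∪ W'`. This supplies new representatives of infinite pieces after a
perturbation. -/
theorem AgreeOff.exists_infinite_comp {G G' H : SimpleGraph V} {W W' : Set V} (hW : W.Finite)
    (hW' : W'.Finite) (hG : AgreeOff W' G G')
    (h : ∀ u v, G.Adj u v → ¬H.Adj u v → u ∈ W ∧ v ∈ W) {A : SimpleGraph V} (hA : A ≤ G)
    {x : V} (hx : (A.comp x).Infinite) :
    ∃ z, A.Reachable x z ∧ ((H ⊓ G').comp z).Infinite := by
  obtain ⟨z, -, h1, h2⟩ := SimpleGraph.exists_infinite_comp (H := H ⊓ G') (hW.union hW')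
    (fun u v huv hnuv => by
      by_cases h1 : H.Adj u v
      · refine Or.inr (hG u v fun h2 => hnuv ⟨h1, h2.1 (hA huv)⟩).2
      · exact Or.inl (h u v (hA huv) h1).2) hx
  exact ⟨z, h1, h2⟩

/-- The definition tolerates finite deletions, so `H ⊓ G'` serves as the new witness: each infinite
piece of `H` retains an infinite subpiece, and pieces separated in `H` stay separated in a smaller
graph. -/
theorem Furcates.of_agreeOff {G G' : SimpleGraph V} {W' : Set V} (hW' : W'.Finite)
    (hG : AgreeOff W' G G') {k : ℕ} {x : V} (hk : G.Furcates k x)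
    (hx : ∀ v, G.Reachable x v → G'.Reachable x v) : G'.Furcates k x := by
  obtain ⟨H, hH, W, hW, h, y, hy1, hy2, hy3⟩ := hk
  choose y' hy' hy'' using fun i => hG.exists_infinite_comp hW hW' h hH (hy2 i)
  refine ⟨H ⊓ G', inf_le_right, W ∪ W', hW.union hW', ?_, y', ?_, hy'', ?_⟩
  · intro u v huv hnuv
    by_cases h1 : G.Adj u v
    · have := h u v h1 fun h2 => hnuv ⟨h2, huv⟩
      exact ⟨Or.inl this.1, Or.inl this.2⟩
    · have := hG u v fun h2 => h1 (h2.2 huv)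
      exact ⟨Or.inr this.1, Or.inr this.2⟩
  · exact fun i => hx _ ((hy1 i).trans ((hy' i).mono hH))
  · exact fun i j hij hr => hy3 i j hij
      ((hy' i).trans ((hr.mono inf_le_left).trans (hy' j).symm))

/-- The gluing step. The additional piece comes from the cluster of `z`, which `G` separates from
that of `x`; since `H ⊓ G' ≤ G`, it cannot meet the old pieces. -/
theorem Furcates.succ {G G' : SimpleGraph V} {W' : Set V} (hW' : W'.Finite)
    (hG : AgreeOff W' G G') {k : ℕ} {x : V} (hk : G.Furcates k x)
    (hx : ∀ v, G.Reachable x v → G'.Reachable x v) {z : V}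
    (hz : ((G ⊓ G').comp z).Infinite) (hxz : ¬G.Reachable x z) (hxz' : G'.Reachable x z) :
    G'.Furcates (k + 1) x := by
  obtain ⟨H, hH, W, hW, h, y, hy1, hy2, hy3⟩ := hk
  choose y' hy' hy'' using fun i => hG.exists_infinite_comp hW hW' h hH (hy2 i)
  obtain ⟨w, hw, hw'⟩ := hG.exists_infinite_comp hW hW' h (A := G ⊓ G') inf_le_left hz
  have key : ∀ i, ¬(H ⊓ G').Reachable w (y' i) := fun i hr => hxz <|
    (hy1 i).trans <| ((hy' i).mono hH).trans <|
      ((hr.mono (inf_le_left.trans hH)).symm).trans (hw.mono inf_le_left).symm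
  refine ⟨H ⊓ G', inf_le_right, W ∪ W', hW.union hW', ?_, Fin.cons w y', ?_, ?_, ?_⟩
  · intro u v huv hnuv
    by_cases h1 : G.Adj u v
    · have := h u v h1 fun h2 => hnuv ⟨h2, huv⟩
      exact ⟨Or.inl this.1, Or.inl this.2⟩
    · have := hG u v fun h2 => h1 (h2.2 huv)
      exact ⟨Or.inr this.1, Or.inr this.2⟩
  · intro i
    induction i using Fin.cases with
    | zero => exact hxz'.trans (hw.mono inf_le_right)
    | succ i => exact hx _ ((hy1 i).trans ((hy' i).mono hH))
  · intro i
    induction i using Fin.cases with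
    | zero => exact hw'
    | succ i => exact hy'' i
  · intro i j
    induction i using Fin.cases with
    | zero =>
      induction j using Fin.cases with
      | zero => exact fun hij => absurd rfl hij
      | succ j => exact fun _ => key j
    | succ i =>
      induction j using Fin.cases with
      | zero => exact fun _ hr => key i hr.symm
      | succ j =>
        exact fun hij hr => hy3 i j (fun he => hij (by rw [he]))
          ((hy' i).trans ((hr.mono inf_le_left).trans (hy' j).symm))

/-- The edges with both endpoints in `K`. -/
def within (G : SimpleGraph V) (K : Set V) : SimpleGraph V where
  Adj u v := G.Adj u v ∧ u ∈ K ∧ v ∈ K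
  symm := ⟨fun _ _ h => ⟨h.1.symm, h.2.2, h.2.1⟩⟩
  loopless := ⟨fun _ h => G.loopless.irrefl _ h.1⟩

/-- The edges with no endpoint in `K`. -/
abbrev avoid (G : SimpleGraph V) (K : Set V) : SimpleGraph V := G.within Kᶜ

theorem within_le (G : SimpleGraph V) (K : Set V) : G.within K ≤ G := fun _ _ h => h.1

theorem within_mono (G : SimpleGraph V) {K L : Set V} (h : K ⊆ L) : G.within K ≤ G.within L :=
  fun _ _ h' => ⟨h'.1, h h'.2.1, h h'.2.2⟩

theorem mem_of_within_reachable {G : SimpleGraph V} {K : Set V} {u v : V}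
    (h : (G.within K).Reachable u v) (hu : u ∈ K) : v ∈ K := by
  rw [reachable_iff_reflTransGen] at h
  induction h with
  | refl => exact hu
  | tail _ h _ => exact h.2.2

/-- `K` is connected, and `y 0, y 1, y 2` lie in the component of `K` and in distinct infinite
components of the graph that avoids `K`. -/
structure Trifurcation (G : SimpleGraph V) (K : Set V) (y : Fin 3 → V) : Prop where
  conn : ∀ a ∈ K, ∀ b ∈ K, (G.within K).Reachable a b
  reach : ∀ a ∈ K, ∀ i, G.Reachable a (y i)
  infinite : ∀ i, ((G.avoid K).comp (y i)).Infinite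
  separated : ∀ i j, i ≠ j → ¬(G.avoid K).Reachable (y i) (y j)

theorem exists_finset_within_connected [DecidableEq V] {G : SimpleGraph V} (x : V) {S : Set V}
    (hS : S.Finite) (hSx : S ⊆ G.comp x) :
    ∃ K : Finset V, x ∈ K ∧ S ⊆ K ∧ ∀ a ∈ K, (G.within (K : Set V)).Reachable x a := by
  induction S, hS using Set.Finite.induction_on with
  | empty =>
    exact ⟨{x}, by simp, by simp, fun a ha => by
      rw [Finset.mem_singleton.1 ha]⟩
  | @insert s S _ _ ih =>
    obtain ⟨K, hx, hK, hconn⟩ := ih ((Set.subset_insert _ _).trans hSx)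
    obtain ⟨p⟩ := hSx (Set.mem_insert s S)
    have hp : ∀ {u v : V} (p : G.Walk u v) (a), a ∈ p.support →
        (G.within {a | a ∈ p.support}).Reachable u a := by
      intro u v p
      induction p with
      | nil =>
        intro a ha
        rw [Walk.mem_support_nil_iff] at ha
        rw [ha]
      | @cons u v w h p ih =>
        intro a ha
        rw [Walk.support_cons, List.mem_cons] at ha
        rcases ha with rfl | ha
        · exact Reachable.refl _
        · have h1 : (G.within {a | a ∈ (Walk.cons h p).support}).Adj u v :=
            ⟨h, by simp, by simp⟩
          exact h1.reachable.trans ((ih a ha).mono (within_mono _ fun b hb => by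
            simp only [Set.mem_ofPred_eq, Walk.support_cons, List.mem_cons] at hb ⊢
            exact Or.inr hb))
    refine ⟨K ∪ p.support.toFinset, by simp [hx], ?_, ?_⟩
    · intro a ha
      rcases ha with rfl | ha
      · simp
      · simpa using Or.inl (hK ha)
    · intro a ha
      rcases Finset.mem_union.1 ha with ha | ha
      · exact (hconn a ha).mono (within_mono _ (by simp))
      · exact (hp p a (by simpa using ha)).mono (within_mono _ (fun b hb => by
          simpa using Or.inr hb))

/-- The deleted edges inside the cluster are absorbed into a finite connected set `K`. By local
finiteness, removing `K` costs only finitely many further edges, so each of the three pieces keeps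
an infinite part. -/
theorem Furcates.exists_trifurcation {G : SimpleGraph V}
    (hfin : ∀ v, {u | G.Adj v u}.Finite) {x : V} (h : G.Furcates 3 x) :
    ∃ (K : Finset V) (y : Fin 3 → V), x ∈ K ∧ G.Trifurcation K y := by
  classical
  obtain ⟨H, hH, W, hW, h, y, hy1, hy2, hy3⟩ := h
  obtain ⟨K, hxK, hWK, hK⟩ := exists_finset_within_connected (G := G) x
    (hW.inter_of_left (G.comp x)) Set.inter_subset_right
  -- Neighbours of `K` are included because an edge lost by avoiding `K` may have only its first
  -- endpoint in `K`.
  have hW2 : ((K : Set V) ∪ ⋃ v ∈ (K : Set V), {u | G.Adj v u}).Finite :=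
    K.finite_toSet.union (K.finite_toSet.biUnion fun v _ => hfin v)
  choose y' hy' hy'' hy''' using fun i => SimpleGraph.exists_infinite_comp (G := H) (H := G.avoid K)
    hW2 (fun u v huv hn => by
      by_cases hv : v ∈ K
      · exact Or.inl hv
      · have hu : u ∈ K := by
          by_contra hu
          exact hn ⟨hH huv, hu, hv⟩
        exact Or.inr (Set.mem_biUnion (show u ∈ (K : Set V) from hu) (hH huv))) (hy2 i)
  have hxy : ∀ i, G.Reachable x (y' i) := fun i => (hy1 i).trans ((hy'' i).mono hH)
  refine ⟨K, y', hxK, fun a ha b hb => (hK a ha).symm.trans (hK b hb), fun a ha i =>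
    ((hK a ha).mono (within_le _ _)).symm.trans (hxy i), hy''', ?_⟩
  intro i j hij hr
  -- A path avoiding `K` in the cluster of `x` uses no deleted edge: the ends of a deleted edge lie
  -- in `W`, and the part of `W` in this cluster is contained in `K`.
  have key : ∀ b, (G.avoid K).Reachable (y' i) b → H.Reachable (y' i) b := by
    intro b hb
    have hb' := hb
    rw [reachable_iff_reflTransGen] at hb
    induction hb with
    | refl => exact Reachable.refl _
    | @tail b c hb hbc ih =>
      have hb := (reachable_iff_reflTransGen _ _).2 hb
      refine (ih hb).trans (Adj.reachable ?_)
      by_contra hnot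
      exact hbc.2.1 (hWK ⟨(h b c hbc.1 hnot).1, (hxy i).trans (hb.mono (within_le _ _))⟩)
  exact hy3 i j hij ((hy'' i).trans ((key _ hr).trans (hy'' j).symm))

end SimpleGraph

/-! ### The Burton–Keane count of disjoint trifurcations. -/

/-- A laminar family of disjoint pairs of nonempty subsets of `Y` has at most `|Y|` members. -/
theorem Finset.card_le_card_of_laminar {ι β : Type*} [DecidableEq ι] [DecidableEq β]
    (T : Finset ι) : ∀ (Y : Finset β) (A B : ι → Finset β),
    (∀ t ∈ T, A t ⊆ Y ∧ B t ⊆ Y ∧ (A t).Nonempty ∧ (B t).Nonempty ∧ Disjoint (A t) (B t)) →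
    (∀ s ∈ T, ∀ t ∈ T, s ≠ t → A t ∪ B t ⊆ A s ∨ A t ∪ B t ⊆ B s ∨ A s ∪ B s ⊆ A t ∨
      A s ∪ B s ⊆ B t ∨ Disjoint (A s ∪ B s) (A t ∪ B t)) → T.card ≤ Y.card := by
  induction hn : T.card generalizing T with
  | zero => intros; exact Nat.zero_le _
  | succ n ih =>
    intro Y A B h1 h2
    have hT : T.Nonempty := Finset.card_pos.1 (by omega)
    -- Induction removes a pair with smallest union together with one point `a` of it. By minimality
    -- no other pair fits inside `A s` or inside `B s`.
    obtain ⟨s, hs, hmin⟩ := T.exists_min_image (fun t => (A t ∪ B t).card) hT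
    obtain ⟨hA, hB, ⟨a, ha⟩, ⟨b, hb⟩, hdisj⟩ := h1 s hs
    have hab : a ≠ b := fun h => Finset.disjoint_left.1 hdisj ha (h ▸ hb)
    have key : ∀ t ∈ T, t ≠ s → A s ∪ B s ⊆ A t ∨ A s ∪ B s ⊆ B t ∨
        Disjoint (A s ∪ B s) (A t ∪ B t) := by
      intro t ht hts
      have hlt : ∀ C D : Finset β, C.Nonempty → Disjoint C D → A t ∪ B t ⊆ D →
          C ∪ D = A s ∪ B s → False := by
        intro C D hC hCD hsub heq
        have h3 := hmin t ht
        rw [← heq, Finset.card_union_of_disjoint hCD] at h3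
        have := Finset.card_le_card hsub
        have := hC.card_pos
        omega
      rcases h2 s hs t ht hts.symm with h | h | h | h | h
      · exact (hlt _ _ ⟨b, hb⟩ hdisj.symm h (Finset.union_comm _ _)).elim
      · exact (hlt _ _ ⟨a, ha⟩ hdisj h rfl).elim
      · exact Or.inl h
      · exact Or.inr (Or.inl h)
      · exact Or.inr (Or.inr h)
    have haY : a ∈ Y := hA ha
    -- A remaining set that contains `a` contains all of `A s ∪ B s`, hence also `b`, and so
    -- survives the loss of `a`.
    have hnonempty : ∀ t ∈ T.erase s, ((A t).erase a).Nonempty ∧ ((B t).erase a).Nonempty := by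
      intro t ht
      rw [Finset.mem_erase] at ht
      obtain ⟨-, -, ⟨a', ha'⟩, ⟨b', hb'⟩, hd⟩ := h1 t ht.2
      have hA' : a ∈ A t → b ∈ A t := fun h => by
        rcases key t ht.2 ht.1 with h' | h' | h'
        · exact h' (Finset.mem_union_right _ hb)
        · exact (Finset.disjoint_left.1 hd h (h' (Finset.mem_union_left _ ha))).elim
        · exact (Finset.disjoint_left.1 h' (Finset.mem_union_left _ ha)
            (Finset.mem_union_left _ h)).elim
      have hB' : a ∈ B t → b ∈ B t := fun h => by
        rcases key t ht.2 ht.1 with h' | h' | h'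
        · exact (Finset.disjoint_left.1 hd (h' (Finset.mem_union_left _ ha)) h).elim
        · exact h' (Finset.mem_union_right _ hb)
        · exact (Finset.disjoint_left.1 h' (Finset.mem_union_left _ ha)
            (Finset.mem_union_right _ h)).elim
      constructor
      · by_cases h : a ∈ A t
        · exact ⟨b, Finset.mem_erase.2 ⟨hab.symm, hA' h⟩⟩
        · exact ⟨a', Finset.mem_erase.2 ⟨fun he => h (he ▸ ha'), ha'⟩⟩
      · by_cases h : a ∈ B t
        · exact ⟨b, Finset.mem_erase.2 ⟨hab.symm, hB' h⟩⟩
        · exact ⟨b', Finset.mem_erase.2 ⟨fun he => h (he ▸ hb'), hb'⟩⟩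
    have := ih (T.erase s) (by rw [Finset.card_erase_of_mem hs, hn]; rfl) (Y.erase a)
      (fun t => (A t).erase a) (fun t => (B t).erase a)
      (fun t ht => by
        obtain ⟨hA', hB', -, -, hd⟩ := h1 t (Finset.mem_of_mem_erase ht)
        exact ⟨Finset.erase_subset_erase _ hA', Finset.erase_subset_erase _ hB',
          (hnonempty t ht).1, (hnonempty t ht).2,
          hd.mono (Finset.erase_subset _ _) (Finset.erase_subset _ _)⟩)
      (fun t ht u hu htu => by
        simp only [← Finset.erase_union_distrib]
        rcases h2 t (Finset.mem_of_mem_erase ht) u (Finset.mem_of_mem_erase hu) htu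
          with h | h | h | h | h
        · exact Or.inl (Finset.erase_subset_erase _ h)
        · exact Or.inr (Or.inl (Finset.erase_subset_erase _ h))
        · exact Or.inr (Or.inr (Or.inl (Finset.erase_subset_erase _ h)))
        · exact Or.inr (Or.inr (Or.inr (Or.inl (Finset.erase_subset_erase _ h))))
        · exact Or.inr (Or.inr (Or.inr (Or.inr
            (h.mono (Finset.erase_subset _ _) (Finset.erase_subset _ _))))))
    rw [Finset.card_erase_of_mem haY] at this
    have := Finset.card_pos.2 ⟨a, haY⟩
    omega

namespace SimpleGraph

variable {V : Type*}

/-- A branch of `K` that misses the connected set `K'` can be joined to `K` without touching `K'`.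
Branch and `K` therefore lie in one component of the complement of `K'`. -/
theorem comp_avoid_subset {G : SimpleGraph V} {K K' : Set V}
    (hK : ∀ a ∈ K, ∀ b ∈ K, (G.within K).Reachable a b)
    (hK' : ∀ a ∈ K', ∀ b ∈ K', (G.within K').Reachable a b) (hd : Disjoint K K')
    {a a' y : V} (ha : a ∈ K) (ha' : a' ∈ K') (hy : y ∉ K) (hay : G.Reachable a y)
    (hn : ¬(G.avoid K).Reachable a' y) : (G.avoid K).comp y ⊆ (G.avoid K').comp a := by
  have hsub : K ⊆ K'ᶜ := hd.subset_compl_right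
  have hsub' : K' ⊆ Kᶜ := hd.subset_compl_left
  have hnot : ∀ b, (G.avoid K).Reachable y b → b ∉ K' := fun b hb hbK => hn
    (((hK' a' ha' b hbK).mono (within_mono _ hsub')).trans hb.symm)
  have h1 : ∀ b, (G.avoid K).Reachable y b → (G.avoid K').Reachable y b := by
    intro b hb
    rw [reachable_iff_reflTransGen] at hb
    induction hb with
    | refl => exact Reachable.refl _
    | @tail b c hb hbc ih =>
      have hb := (reachable_iff_reflTransGen _ _).2 hb
      refine ih.trans (Adj.reachable ⟨hbc.1, hnot b hb, hnot c (hb.trans hbc.reachable)⟩)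
  have h2 : ∀ b, G.Reachable y b → (G.avoid K).Reachable y b ∨
      ∃ c ∈ K, (G.avoid K').Reachable y c := by
    intro b hb
    rw [reachable_iff_reflTransGen] at hb
    induction hb with
    | refl => exact Or.inl (Reachable.refl _)
    | @tail b c hb hbc ih =>
      rcases ih with ih | ih
      · by_cases hc : c ∈ K
        · exact Or.inr ⟨c, hc, (h1 b ih).trans (Adj.reachable ⟨hbc, hnot b ih, hsub hc⟩)⟩
        · exact Or.inl (ih.trans
            (Adj.reachable ⟨hbc, mem_of_within_reachable ih hy, hc⟩))
      · exact Or.inr ih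
  have h3 : (G.avoid K').Reachable a y := by
    rcases h2 a hay.symm with h | ⟨c, hc, h⟩
    · exact absurd ha (mem_of_within_reachable h hy)
    · exact ((hK a ha c hc).mono (within_mono _ hsub)).trans h.symm
  exact fun v hv => h3.trans (h1 v hv)

theorem Trifurcation.notMem {G : SimpleGraph V} {K : Set V} {y : Fin 3 → V}
    (h : G.Trifurcation K y) (i : Fin 3) : y i ∉ K := by
  intro hi
  refine h.infinite i ((Set.finite_singleton (y i)).subset ?_)
  intro v hv
  rw [mem_comp, reachable_iff_reflTransGen] at hv
  rcases hv.cases_head with h1 | ⟨c, h1, -⟩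
  · exact h1.symm
  · exact absurd hi h1.2.1

/-- The common root `r` lies in none of the chosen branches. If `K'` sits in a chosen branch of `K`,
then `r` is on the same side of `K'` as `K`, so the chosen branches of `K'` point away from `K` and
are swallowed by that branch. Otherwise both branches of `K` lie in the component containing `K`
outside `K'`, which is either one of the branches of `K'` or disjoint from both. -/
theorem comp_laminar {G : SimpleGraph V} {K K' : Set V}
    (hK : ∀ a ∈ K, ∀ b ∈ K, (G.within K).Reachable a b)
    (hK' : ∀ a ∈ K', ∀ b ∈ K', (G.within K').Reachable a b) (hd : Disjoint K K')
    {a a' r y z y' z' : V} (ha : a ∈ K) (ha' : a' ∈ K') (haa : G.Reachable a a')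
    (hr : r ∉ K) (har : G.Reachable a r)
    (hy : y ∉ K) (hz : z ∉ K) (hy' : y' ∉ K') (hz' : z' ∉ K')
    (hay : G.Reachable a y) (haz : G.Reachable a z)
    (hay' : G.Reachable a y') (haz' : G.Reachable a z')
    (hry : ¬(G.avoid K).Reachable r y) (hrz : ¬(G.avoid K).Reachable r z)
    (hry' : ¬(G.avoid K').Reachable r y') (hrz' : ¬(G.avoid K').Reachable r z')
    (D D' : V → Set V) (hD : D = (G.avoid K).comp) (hD' : D' = (G.avoid K').comp) :
    D' y' ∪ D' z' ⊆ D y ∨ D' y' ∪ D' z' ⊆ D z ∨ D y ∪ D z ⊆ D' y' ∨ D y ∪ D z ⊆ D' z' ∨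
      Disjoint (D y ∪ D z) (D' y' ∪ D' z') := by
  subst hD hD'
  have e1 : ∀ w, w ∉ K → G.Reachable a w → ¬(G.avoid K).Reachable a' w →
      (G.avoid K).comp w ⊆ (G.avoid K').comp a := fun w hw haw hn =>
    comp_avoid_subset hK hK' hd ha ha' hw haw hn
  have e2 : ∀ w, w ∉ K' → G.Reachable a w → ¬(G.avoid K').Reachable a w →
      (G.avoid K').comp w ⊆ (G.avoid K).comp a' := fun w hw haw hn =>
    comp_avoid_subset hK' hK hd.symm ha' ha hw (haa.symm.trans haw) hn
  have main : ∀ w, ¬(G.avoid K).Reachable r w → (G.avoid K).Reachable a' w →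
      (G.avoid K').comp y' ∪ (G.avoid K').comp z' ⊆ (G.avoid K).comp w := by
    intro w hrw haw
    have h1 : (G.avoid K').Reachable a r :=
      e1 r hr har (fun h => hrw (h.symm.trans haw)) (Reachable.refl r)
    rw [← haw.comp_eq]
    exact Set.union_subset (e2 y' hy' hay' fun h => hry' (h1.symm.trans h))
      (e2 z' hz' haz' fun h => hrz' (h1.symm.trans h))
  by_cases hy1 : (G.avoid K).Reachable a' y
  · exact Or.inl (main y hry hy1)
  by_cases hz1 : (G.avoid K).Reachable a' z
  · exact Or.inr (Or.inl (main z hrz hz1))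
  have h := Set.union_subset (e1 y hy hay hy1) (e1 z hz haz hz1)
  by_cases hy2 : (G.avoid K').Reachable a y'
  · exact Or.inr (Or.inr (Or.inl (hy2.comp_eq ▸ h)))
  by_cases hz2 : (G.avoid K').Reachable a z'
  · exact Or.inr (Or.inr (Or.inr (Or.inl (hz2.comp_eq ▸ h))))
  refine Or.inr (Or.inr (Or.inr (Or.inr (Set.disjoint_left.2 ?_))))
  rintro v hv (hv' | hv')
  · exact hy2 ((h hv).trans (mem_comp.1 hv').symm)
  · exact hz2 ((h hv).trans (mem_comp.1 hv').symm)

theorem Reachable.exists_boundary {G : SimpleGraph V} {L Y : Set V}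
    (hY : ∀ u ∈ L, ∀ v ∉ L, G.Adj u v → v ∈ Y) {u v : V} (h : G.Reachable u v) (hu : u ∈ L)
    (hv : v ∉ L) : ∃ w ∈ Y, G.Reachable u w := by
  have : v ∈ L ∨ ∃ w ∈ Y, G.Reachable u w := by
    rw [reachable_iff_reflTransGen] at h
    induction h with
    | refl => exact Or.inl hu
    | @tail b c hb hbc ih =>
      by_cases hb' : b ∈ L
      · by_cases hc : c ∈ L
        · exact Or.inl hc
        · exact Or.inr ⟨c, hY b hb' c hc hbc,
            ((reachable_iff_reflTransGen _ _).2 hb).trans hbc.reachable⟩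
      · exact Or.inr (ih hb' |>.resolve_left hb')
  exact this.resolve_left hv

/-- The number of disjoint trifurcations in a finite region is at most the size of its
boundary. -/
theorem card_trifurcations_le {ι : Type*} {G : SimpleGraph V} (T : Finset ι) (K : ι → Set V)
    (y : ι → Fin 3 → V) {L : Set V} (hL : L.Finite) (Y : Finset V)
    (hY : ∀ u ∈ L, ∀ v ∉ L, G.Adj u v → v ∈ Y) (hT : ∀ t ∈ T, G.Trifurcation (K t) (y t))
    (hne : ∀ t ∈ T, (K t).Nonempty) (hKL : ∀ t ∈ T, K t ⊆ L) (hyL : ∀ t ∈ T, ∀ i, y t i ∈ L)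
    (hd : ∀ s ∈ T, ∀ t ∈ T, s ≠ t → Disjoint (K s) (K t)) : T.card ≤ Y.card := by
  classical
  rcases T.eq_empty_or_nonempty with rfl | ⟨t₀, ht₀⟩
  · exact Nat.zero_le _
  have : Nonempty V := ⟨y t₀ 0⟩
  -- One root outside `L` per infinite cluster orients all its trifurcations consistently: at most
  -- one of three branches holds the root, and the other two form the pair fed to the laminar bound.
  have hroot : ∃ r : G.ConnectedComponent → V, ∀ x, (G.comp x).Infinite →
      G.Reachable x (r (G.connectedComponentMk x)) ∧ r (G.connectedComponentMk x) ∉ L := by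
    have : ∀ c : G.ConnectedComponent, ∃ r, ∀ x, G.connectedComponentMk x = c →
        (G.comp x).Infinite → G.Reachable x r ∧ r ∉ L := by
      intro c
      induction c using ConnectedComponent.ind with
      | h v =>
        by_cases hv : (G.comp v).Infinite
        · obtain ⟨r, hr, hr'⟩ := (hv.sdiff hL).nonempty
          exact ⟨r, fun x hx _ => ⟨(ConnectedComponent.eq.1 hx).trans hr, hr'⟩⟩
        · exact ⟨v, fun x hx hx' => absurd ((ConnectedComponent.eq.1 hx).comp_eq ▸ hx') hv⟩
    choose r hr using this
    exact ⟨r, fun x hx => hr _ x rfl hx⟩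
  obtain ⟨r, hr⟩ := hroot
  have hsel : ∀ t, t ∈ T → ∃ (a : V) (i j : Fin 3), a ∈ K t ∧ i ≠ j ∧ (G.comp a).Infinite ∧
      ¬(G.avoid (K t)).Reachable (r (G.connectedComponentMk a)) (y t i) ∧
      ¬(G.avoid (K t)).Reachable (r (G.connectedComponentMk a)) (y t j) := by
    intro t ht
    obtain ⟨a, ha⟩ := hne t ht
    have h := hT t ht
    have hinf : (G.comp a).Infinite := (h.infinite 0).mono fun v hv =>
      (h.reach a ha 0).trans (Reachable.mono (within_le _ _) hv)
    set ρ := r (G.connectedComponentMk a)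
    have hsep : ∀ i j, i ≠ j → (G.avoid (K t)).Reachable ρ (y t i) →
        ¬(G.avoid (K t)).Reachable ρ (y t j) := fun i j hij h1 h2 =>
      h.separated i j hij (h1.symm.trans h2)
    refine ⟨a, ?_⟩
    by_cases h0 : (G.avoid (K t)).Reachable ρ (y t 0)
    · exact ⟨1, 2, ha, by decide, hinf, hsep 0 1 (by decide) h0, hsep 0 2 (by decide) h0⟩
    by_cases h1 : (G.avoid (K t)).Reachable ρ (y t 1)
    · exact ⟨0, 2, ha, by decide, hinf, h0, hsep 1 2 (by decide) h1⟩
    · exact ⟨0, 1, ha, by decide, hinf, h0, h1⟩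
  choose! a i j ha hij hinf hri hrj using hsel
  have hne' : ∀ t ∈ T, ∀ k, (Y.filter (· ∈ (G.avoid (K t)).comp (y t k))).Nonempty := by
    intro t ht k
    obtain ⟨v, hv, hv'⟩ := (((hT t ht).infinite k).sdiff hL).nonempty
    obtain ⟨w, hw, hw'⟩ := Reachable.exists_boundary (G := G.avoid (K t)) (L := L)
      (Y := (Y : Set V)) (fun u hu v hv h => hY u hu v hv h.1) hv (hyL t ht k) hv'
    exact ⟨w, by simpa [mem_comp] using ⟨hw, hw'⟩⟩
  refine Finset.card_le_card_of_laminar T Y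
    (fun t => Y.filter (· ∈ (G.avoid (K t)).comp (y t (i t))))
    (fun t => Y.filter (· ∈ (G.avoid (K t)).comp (y t (j t)))) ?_ ?_
  · intro t ht
    refine ⟨Finset.filter_subset _ _, Finset.filter_subset _ _, hne' t ht _, hne' t ht _, ?_⟩
    rw [Finset.disjoint_left]
    intro v hv hv'
    simp only [Finset.mem_filter, mem_comp] at hv hv'
    exact (hT t ht).separated _ _ (hij t ht) (hv.2.trans hv'.2.symm)
  · intro s hs t ht hst
    have conv : ∀ P Q R : Set V, P ∪ Q ⊆ R →
        Y.filter (· ∈ P) ∪ Y.filter (· ∈ Q) ⊆ Y.filter (· ∈ R) := by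
      intro P Q R h v hv
      simp only [Finset.mem_union, Finset.mem_filter] at hv ⊢
      rcases hv with hv | hv
      · exact ⟨hv.1, h (Or.inl hv.2)⟩
      · exact ⟨hv.1, h (Or.inr hv.2)⟩
    have conv' : ∀ P Q R S : Set V, Disjoint (P ∪ Q) (R ∪ S) →
        Disjoint (Y.filter (· ∈ P) ∪ Y.filter (· ∈ Q))
          (Y.filter (· ∈ R) ∪ Y.filter (· ∈ S)) := by
      intro P Q R S h
      rw [Finset.disjoint_left]
      intro v hv hv'
      simp only [Finset.mem_union, Finset.mem_filter] at hv hv'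
      exact Set.disjoint_left.1 h (hv.imp And.right And.right) (hv'.imp And.right And.right)
    by_cases hst' : G.Reachable (a s) (a t)
    · have hroot' : r (G.connectedComponentMk (a t)) = r (G.connectedComponentMk (a s)) := by
        rw [ConnectedComponent.eq.2 hst']
      have hrs := hr (a s) (hinf s hs)
      have := comp_laminar (hT s hs).conn (hT t ht).conn (hd s hs t ht hst) (ha s hs) (ha t ht)
        hst' (fun h => hrs.2 (hKL s hs h)) hrs.1
        ((hT s hs).notMem (i s)) ((hT s hs).notMem (j s)) ((hT t ht).notMem (i t))
        ((hT t ht).notMem (j t)) ((hT s hs).reach _ (ha s hs) _) ((hT s hs).reach _ (ha s hs) _)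
        (hst'.trans ((hT t ht).reach _ (ha t ht) _))
        (hst'.trans ((hT t ht).reach _ (ha t ht) _)) (hri s hs) (hrj s hs)
        (hroot' ▸ hri t ht) (hroot' ▸ hrj t ht) _ _ rfl rfl
      rcases this with h | h | h | h | h
      · exact Or.inl (conv _ _ _ h)
      · exact Or.inr (Or.inl (conv _ _ _ h))
      · exact Or.inr (Or.inr (Or.inl (conv _ _ _ h)))
      · exact Or.inr (Or.inr (Or.inr (Or.inl (conv _ _ _ h))))
      · exact Or.inr (Or.inr (Or.inr (Or.inr (conv' _ _ _ _ h))))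
    · refine Or.inr (Or.inr (Or.inr (Or.inr (conv' _ _ _ _ ?_))))
      have hcl : ∀ u ∈ T, ∀ v k, v ∈ (G.avoid (K u)).comp (y u k) → G.Reachable (a u) v :=
        fun u hu v k hv => ((hT u hu).reach _ (ha u hu) k).trans (Reachable.mono (within_le _ _) hv)
      rw [Set.disjoint_left]
      intro v hv hv'
      have h1 : G.Reachable (a s) v := hv.elim (hcl s hs v _) (hcl s hs v _)
      have h2 : G.Reachable (a t) v := hv'.elim (hcl t ht v _) (hcl t ht v _)
      exact hst' (h1.trans h2.symm)

end SimpleGraph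

/-! ### Geometry of feasible pairs and blue segments. -/

namespace OneChoice

variable {d : ℕ}

/-- The opposite direction. -/
def Direction.rev (a : Direction d) : Direction d := (a.1, !a.2)

theorem Direction.vec_rev (a : Direction d) : a.rev.vec = -a.vec := by
  obtain ⟨i, b⟩ := a
  cases b; all_goals simp [Direction.rev, Direction.vec, ← Pi.single_neg]

theorem Direction.vec_apply_self (a : Direction d) : a.vec a.1 = if a.2 then 1 else -1 := by
  simp [Direction.vec]

theorem Direction.vec_apply_of_ne (a : Direction d) {j : Fin d} (h : j ≠ a.1) : a.vec j = 0 := by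
  simp [Direction.vec, h]

theorem Direction.vec_ne_zero (a : Direction d) : a.vec ≠ 0 := by
  intro h
  have := congrFun h a.1
  rw [a.vec_apply_self] at this
  split_ifs at this
  simp at this

theorem add_smul_vec_apply_self (u : Site d) (a : Direction d) (n : ℕ) :
    (u + n • a.vec) a.1 = u a.1 + if a.2 then (n : ℤ) else -n := by
  rw [Pi.add_apply, Pi.smul_apply, a.vec_apply_self]
  split_ifs <;> simp

/-- The site `v` is the next occupied site from the occupied site `u` in direction `a`. -/
def Next (ω : SiteConfig d) (u : Site d) (a : Direction d) (v : Site d) : Prop :=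
  Feasible ω u v ∧ ∃ n : ℕ, v = u + n • a.vec

theorem declares_iff {ω : SiteConfig d} {δ : DirConfig d} {u v : Site d} :
    Declares ω δ u v ↔ Next ω u (δ u) v := Iff.rfl

theorem Feasible.symm {ω : SiteConfig d} {u v : Site d} (h : Feasible ω u v) :
    Feasible ω v u := by
  obtain ⟨h1, h2, h3, h4⟩ := h
  refine ⟨h2, h1, by simpa only [ne_comm] using h3, fun w hw hw' => ?_⟩
  rw [Set.uIcc_comm] at hw
  exact (h4 w hw hw').symm

theorem Feasible.ne {ω : SiteConfig d} {u v : Site d} (h : Feasible ω u v) : u ≠ v := by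
  obtain ⟨i, hi, -⟩ := h.2.2.1
  exact fun h' => hi (congrFun h' i)

theorem mem_uIcc_iff {u v w : Site d} : w ∈ Set.uIcc u v ↔
    ∀ i, (u i ≤ w i ∧ w i ≤ v i) ∨ (v i ≤ w i ∧ w i ≤ u i) := by
  rw [← Set.pi_univ_uIcc]
  simp only [Set.mem_univ_pi]
  exact forall_congr' fun i => Set.mem_uIcc

theorem mem_uIcc_add_smul (u : Site d) (a : Direction d) {k n : ℕ} (h : k ≤ n) :
    u + k • a.vec ∈ Set.uIcc u (u + n • a.vec) := by
  rw [mem_uIcc_iff]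
  intro i
  have h' : (k : ℤ) ≤ n := by exact_mod_cast h
  by_cases hi : i = a.1
  · subst hi
    rw [add_smul_vec_apply_self, add_smul_vec_apply_self]
    split_ifs <;> omega
  · simp [a.vec_apply_of_ne hi]

theorem eq_add_smul_of_mem_uIcc {u w : Site d} {a : Direction d} {n : ℕ}
    (h : w ∈ Set.uIcc u (u + n • a.vec)) : ∃ k ≤ n, w = u + k • a.vec := by
  rw [mem_uIcc_iff] at h
  have h1 : ∀ i, i ≠ a.1 → w i = u i := by
    intro i hi
    have := h i
    simp only [Pi.add_apply, Pi.smul_apply, a.vec_apply_of_ne hi, smul_zero, add_zero] at this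
    omega
  have h2 := h a.1
  rw [add_smul_vec_apply_self] at h2
  by_cases hb : a.2 = true
  · rw [if_pos hb] at h2
    refine ⟨(w a.1 - u a.1).toNat, by omega, ?_⟩
    funext i
    by_cases hi : i = a.1
    · subst hi
      rw [add_smul_vec_apply_self]
      simp only [hb]
      grind
    · simp [a.vec_apply_of_ne hi, h1 i hi]
  · rw [if_neg hb] at h2
    refine ⟨(u a.1 - w a.1).toNat, by omega, ?_⟩
    funext i
    by_cases hi : i = a.1
    · subst hi
      rw [add_smul_vec_apply_self]
      simp only [hb]
      grind
    · simp [a.vec_apply_of_ne hi, h1 i hi]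

theorem Next.unique {ω : SiteConfig d} {u v v' : Site d} {a : Direction d}
    (h : Next ω u a v) (h' : Next ω u a v') : v = v' := by
  obtain ⟨hf, n, rfl⟩ := h
  obtain ⟨hf', n', rfl⟩ := h'
  rcases le_total n n' with hn | hn
  · exact (hf'.2.2.2 _ (mem_uIcc_add_smul u a hn) hf.2.1).resolve_left hf.ne.symm
  · exact ((hf.2.2.2 _ (mem_uIcc_add_smul u a hn) hf'.2.1).resolve_left hf'.ne.symm).symm

theorem Next.rev {ω : SiteConfig d} {u v : Site d} {a : Direction d}
    (h : Next ω u a v) : Next ω v a.rev u := by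
  obtain ⟨hf, n, rfl⟩ := h
  exact ⟨hf.symm, n, by simp [Direction.vec_rev]⟩

theorem Feasible.exists_next {ω : SiteConfig d} {u v : Site d} (h : Feasible ω u v) :
    ∃ a, Next ω u a v := by
  obtain ⟨i, hi, hi'⟩ := h.2.2.1
  have h1 : ∀ j, j ≠ i → v j = u j := fun j hj => by
    by_contra hne
    exact hj (hi' j (Ne.symm hne))
  rcases lt_or_gt_of_ne hi with hlt | hlt
  · refine ⟨(i, true), h, (v i - u i).toNat, ?_⟩
    funext j
    by_cases hj : j = i
    · subst hj
      simp [Direction.vec]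
      omega
    · simp [Direction.vec, hj, h1 j hj]
  · refine ⟨(i, false), h, (u i - v i).toNat, ?_⟩
    funext j
    by_cases hj : j = i
    · subst hj
      simp [Direction.vec]
      omega
    · simp [Direction.vec, hj, h1 j hj]

/-- There are occupied sites in every direction from every site. -/
def Unbounded (ω : SiteConfig d) : Prop :=
  ∀ (u : Site d) (a : Direction d), ∃ n : ℕ, 0 < n ∧ ω (u + n • a.vec) = true

theorem existsUnique_ne_add_smul (u : Site d) (a : Direction d) {n : ℕ} (hn : 0 < n) :
    ∃! i, u i ≠ (u + n • a.vec) i := by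
  refine ⟨a.1, ?_, ?_⟩
  · beta_reduce
    rw [add_smul_vec_apply_self]
    split_ifs <;> omega
  · intro i hi
    by_contra hne
    exact hi (by simp [a.vec_apply_of_ne hne])

theorem Unbounded.exists_next {ω : SiteConfig d} (h : Unbounded ω) {u : Site d}
    (hu : ω u = true) (a : Direction d) : ∃ v, Next ω u a v := by
  classical
  have hex := h u a
  set n := Nat.find hex with hn
  obtain ⟨hn0, hn1⟩ := Nat.find_spec hex
  refine ⟨u + n • a.vec, ⟨hu, hn1, existsUnique_ne_add_smul u a hn0, ?_⟩, n, rfl⟩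
  intro w hw hw'
  obtain ⟨k, hk, rfl⟩ := eq_add_smul_of_mem_uIcc hw
  rcases Nat.eq_zero_or_pos k with rfl | hk0
  · left; simp
  · right
    have : n ≤ k := Nat.find_min' hex ⟨hk0, hw'⟩
    rw [le_antisymm hk this]

theorem sum_abs_sub_add_vec (u : Site d) (a : Direction d) :
    ∑ i, |u i - (u + a.vec) i| = 1 := by
  rw [Finset.sum_eq_single a.1]
  · simp only [Pi.add_apply, a.vec_apply_self]
    split_ifs <;> simp
  · intro b _ hb
    simp [a.vec_apply_of_ne hb]
  · simp

theorem BlueSegment.symm {ω : SiteConfig d} {δ : DirConfig d} {u v : Site d}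
    (h : BlueSegment ω δ u v) : BlueSegment ω δ v u := Or.symm h

theorem BlueSegment.feasible {ω : SiteConfig d} {δ : DirConfig d} {u v : Site d}
    (h : BlueSegment ω δ u v) : Feasible ω u v := h.elim And.left fun h => h.1.symm

/-- All sites of a blue segment are connected. -/
theorem BlueSegment.reachable {ω : SiteConfig d} {δ : DirConfig d} {u v w : Site d}
    (h : BlueSegment ω δ u v) (hw : w ∈ Set.uIcc u v) : (blueGraph ω δ).Reachable u w := by
  obtain ⟨a, -, n, hn⟩ := h.feasible.exists_next
  subst hn
  obtain ⟨k, hk, rfl⟩ := eq_add_smul_of_mem_uIcc hw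
  clear hw
  induction k with
  | zero => simp
  | succ k ih =>
    refine (ih (by omega)).trans (SimpleGraph.Adj.reachable ⟨?_, _, _, h,
      mem_uIcc_add_smul u a (by omega), mem_uIcc_add_smul u a hk⟩)
    rw [succ_nsmul, ← add_assoc]
    exact sum_abs_sub_add_vec _ _

theorem BlueSegment.reachable_right {ω : SiteConfig d} {δ : DirConfig d} {u v : Site d}
    (h : BlueSegment ω δ u v) : (blueGraph ω δ).Reachable u v :=
  h.reachable Set.right_mem_uIcc

theorem Next.blueSegment {ω : SiteConfig d} {δ : DirConfig d} {u v : Site d} {a : Direction d}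
    (h : Next ω u a v) (ha : δ u = a) : BlueSegment ω δ u v := by
  subst ha
  exact Or.inl h

theorem abs_sub_le_one_of_adj {ω : SiteConfig d} {δ : DirConfig d} {x y : Site d}
    (h : (blueGraph ω δ).Adj x y) (i : Fin d) : |x i - y i| ≤ 1 := by
  rw [← h.1]
  exact Finset.single_le_sum (f := fun i => |x i - y i|) (fun _ _ => abs_nonneg _)
    (Finset.mem_univ i)

theorem finite_setOf_adj (ω : SiteConfig d) (δ : DirConfig d) (x : Site d) :
    {y | (blueGraph ω δ).Adj x y}.Finite := by
  refine (Set.finite_Icc (x - 1) (x + 1)).subset ?_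
  intro y hy
  have := fun i => abs_le.1 (abs_sub_le_one_of_adj hy i)
  constructor <;> intro i <;> have := this i <;> simp <;> omega

/-- An infinite cluster contains an occupied site. -/
theorem exists_occupied_of_infinite {ω : SiteConfig d} {δ : DirConfig d} {x : Site d}
    (h : ((blueGraph ω δ).comp x).Infinite) :
    ∃ v, ω v = true ∧ (blueGraph ω δ).Reachable x v := by
  obtain ⟨y, hy, hxy⟩ := (h.sdiff (Set.finite_singleton x)).nonempty
  rw [SimpleGraph.mem_comp, SimpleGraph.reachable_iff_reflTransGen] at hy
  rcases hy.cases_head with h1 | ⟨c, ⟨h1, u, v, hb, hx, hc⟩, -⟩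
  · exact absurd h1.symm hxy
  · exact ⟨u, hb.feasible.1, (hb.reachable hx).symm⟩

/-- Modifying finitely many directions affects finitely many edges. -/
theorem exists_agreeOff (ω : SiteConfig d) {δ δ' : DirConfig d} (h : {x | δ x ≠ δ' x}.Finite) :
    ∃ W : Set (Site d), W.Finite ∧ (blueGraph ω δ).AgreeOff W (blueGraph ω δ') := by
  set W : Set (Site d) := ⋃ x ∈ {x | δ x ≠ δ' x}, ⋃ a : Direction d, ⋃ v ∈ {v | Next ω x a v},
    Set.uIcc x v
  have key : ∀ δ₁ δ₂ : DirConfig d, (∀ x, δ₁ x ≠ δ₂ x → δ x ≠ δ' x) → ∀ x y,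
      (blueGraph ω δ₁).Adj x y → ¬(blueGraph ω δ₂).Adj x y → x ∈ W ∧ y ∈ W := by
    rintro δ₁ δ₂ hδ x y ⟨h1, u, v, hb, hx, hy⟩ hn
    have aux : ∀ u v, Declares ω δ₁ u v → x ∈ Set.uIcc u v → y ∈ Set.uIcc u v →
        x ∈ W ∧ y ∈ W := by
      intro u v hD hx hy
      have hne : δ₁ u ≠ δ₂ u := fun he =>
        hn ⟨h1, u, v, Next.blueSegment (a := δ₁ u) hD he.symm, hx, hy⟩
      simp only [W, Set.mem_iUnion]
      exact ⟨⟨u, hδ u hne, δ₁ u, v, hD, hx⟩, ⟨u, hδ u hne, δ₁ u, v, hD, hy⟩⟩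
    rcases hb with hb | hb
    · exact aux u v hb hx hy
    · rw [Set.uIcc_comm] at hx hy
      exact aux v u hb hx hy
  refine ⟨W, ?_, ?_⟩
  · refine h.biUnion fun x _ => Set.finite_iUnion fun a => Set.Finite.biUnion ?_ fun v _ =>
      Set.finite_uIcc x v
    exact Set.Subsingleton.finite fun v hv v' hv' => Next.unique hv hv'
  · intro x y hxy
    by_cases h1 : (blueGraph ω δ).Adj x y
    · exact key δ δ' (fun _ => id) x y h1 fun h2 => hxy ⟨fun _ => h2, fun _ => h1⟩
    · exact key δ' δ (fun _ => Ne.symm) x y (by tauto) h1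

/-! ### The declaration map, reversal of arrows and gluing of clusters. -/

open Classical in
/-- The site that an occupied site declares. -/
noncomputable def nxt (ω : SiteConfig d) (δ : DirConfig d) (u : Site d) : Site d :=
  if h : ∃ v, Declares ω δ u v then h.choose else u

theorem Declares.nxt_eq {ω : SiteConfig d} {δ : DirConfig d} {u v : Site d}
    (h : Declares ω δ u v) : nxt ω δ u = v := by
  have hex : ∃ v, Declares ω δ u v := ⟨v, h⟩
  rw [nxt, dif_pos hex]
  exact Next.unique hex.choose_spec h

theorem declares_nxt_of_ne {ω : SiteConfig d} {δ : DirConfig d} {u : Site d}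
    (h : nxt ω δ u ≠ u) : Declares ω δ u (nxt ω δ u) := by
  by_cases hex : ∃ v, Declares ω δ u v
  · obtain ⟨v, hv⟩ := hex
    rwa [hv.nxt_eq]
  · exact absurd (by rw [nxt, dif_neg hex]) h

theorem Unbounded.declares_nxt {ω : SiteConfig d} (h : Unbounded ω) (δ : DirConfig d)
    {u : Site d} (hu : ω u = true) : Declares ω δ u (nxt ω δ u) := by
  obtain ⟨v, hv⟩ := h.exists_next hu (δ u)
  rwa [Declares.nxt_eq (declares_iff.2 hv)]

theorem Unbounded.iterate_nxt_occupied {ω : SiteConfig d} (h : Unbounded ω) (δ : DirConfig d)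
    {u : Site d} (hu : ω u = true) (n : ℕ) : ω ((nxt ω δ)^[n] u) = true := by
  induction n with
  | zero => exact hu
  | succ n ih =>
    rw [Function.iterate_succ_apply']
    exact (h.declares_nxt δ ih).1.2.1

/-- Along a path of distinct sites, all arrows but the last can be reversed, which frees the
direction of the first site. -/
theorem exists_reversal (δ : DirConfig d) (y : ℕ → Site d) (a : Direction d) (m : ℕ)
    (hy : ∀ i ≤ m, ∀ j ≤ m, y i = y j → i = j) :
    ∃ δ' : DirConfig d, {x | δ x ≠ δ' x}.Finite ∧ δ' (y 0) = a ∧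
      (∀ i < m, δ' (y (i + 1)) = (δ (y i)).rev) ∧ ∀ u, (∀ i ≤ m, u ≠ y i) → δ' u = δ u := by
  induction m with
  | zero =>
    refine ⟨Function.update δ (y 0) a, (Set.finite_singleton (y 0)).subset ?_, by simp, by simp,
      fun u hu => Function.update_of_ne (hu 0 le_rfl) _ _⟩
    intro x hx
    by_contra hne
    exact hx (Function.update_of_ne hne _ _).symm
  | succ m ih =>
    obtain ⟨δ', h1, h2, h3, h4⟩ := ih fun i hi j hj => hy i (by omega) j (by omega)
    have hne : ∀ i ≤ m, y i ≠ y (m + 1) := fun i hi h => by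
      have := hy i (by omega) (m + 1) le_rfl h
      omega
    refine ⟨Function.update δ' (y (m + 1)) (δ (y m)).rev, (h1.insert (y (m + 1))).subset ?_, ?_,
      ?_, ?_⟩
    · intro x hx
      by_cases hx' : x = y (m + 1)
      · exact Or.inl hx'
      · right
        simpa [Function.update_of_ne hx'] using hx
    · rw [Function.update_of_ne (hne 0 (by omega)), h2]
    · intro i hi
      rcases Nat.lt_succ_iff_lt_or_eq.1 hi with hi | rfl
      · rw [Function.update_of_ne (hne (i + 1) (by omega)), h3 i hi]
      · simp
    · intro u hu
      rw [Function.update_of_ne (hu (m + 1) le_rfl), h4 u fun i hi => hu i (by omega)]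

end OneChoice

namespace SimpleGraph

variable {V : Type*}

/-- For modifications that harm only the cluster of `c`: a path from a point outside that cluster
never enters it, so all its edges survive. -/
theorem Reachable.inf_of_intact {G G' : SimpleGraph V} {c x v : V}
    (h : ∀ u v, G.Adj u v → ¬G.Reachable c u → G'.Adj u v) (hx : ¬G.Reachable c x)
    (hv : G.Reachable x v) : (G ⊓ G').Reachable x v := by
  rw [reachable_iff_reflTransGen] at hv
  induction hv with
  | refl => exact Reachable.refl _
  | @tail b e hb hbe ih =>
    have hb := (reachable_iff_reflTransGen _ _).2 hb
    exact ih.trans (Adj.reachable ⟨hbe, h b e hbe fun h' => hx (h'.trans hb.symm)⟩)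

end SimpleGraph

namespace OneChoice

variable {d : ℕ}

/-- All orbits of the map `nxt` are eventually periodic. -/
def EventuallyPeriodic (ω : SiteConfig d) (δ : DirConfig d) : Prop :=
  ∀ x, ∃ j, ∃ i < j, (nxt ω δ)^[i] x = (nxt ω δ)^[j] x

theorem finite_ne_trans {α β : Type*} {f g h : α → β} (h1 : {x | f x ≠ g x}.Finite)
    (h2 : {x | g x ≠ h x}.Finite) : {x | f x ≠ h x}.Finite := by
  refine (h1.union h2).subset fun x hx => ?_
  by_contra hn
  simp only [Set.mem_union, Set.mem_ofPred_eq, not_or, not_not] at hn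
  exact hx (hn.1.trans hn.2)

/-- A site of an infinite cluster can be given any direction, at the cost of a finite modification
that leaves it in an infinite cluster and that does not harm the other clusters. -/
theorem exists_freeing {ω : SiteConfig d} (hω : Unbounded ω) {δ : DirConfig d}
    (hper : EventuallyPeriodic ω δ) {x : Site d} (hx : ω x = true)
    (hinf : ((blueGraph ω δ).comp x).Infinite) (a : Direction d) :
    ∃ (δ' : DirConfig d) (z : Site d), {x | δ x ≠ δ' x}.Finite ∧ δ' x = a ∧
      ((blueGraph ω δ ⊓ blueGraph ω δ').comp z).Infinite ∧ (blueGraph ω δ).Reachable x z ∧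
      (blueGraph ω δ').Reachable x z ∧
      ∀ u v, (blueGraph ω δ).Adj u v → ¬(blueGraph ω δ).Reachable x u →
        (blueGraph ω δ').Adj u v := by
  classical
  set G := blueGraph ω δ with hG
  set y : ℕ → Site d := fun i => (nxt ω δ)^[i] x with hy
  have hy0 : y 0 = x := rfl
  have hdecl : ∀ i, Declares ω δ (y i) (y (i + 1)) := fun i => by
    have h1 := hω.declares_nxt δ (hω.iterate_nxt_occupied δ hx i)
    have h2 : y (i + 1) = nxt ω δ (y i) := Function.iterate_succ_apply' _ _ _
    rw [h2]
    exact h1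
  -- `n + 1` is the first time the orbit repeats, so the sites from index `i₀` to `n` form the
  -- cycle. The inequality `i₀ < n` is strict because no site declares itself.
  obtain ⟨n, i₀, hi₀, hper₀, hinj⟩ : ∃ n i₀, i₀ < n ∧ y (n + 1) = y i₀ ∧
      ∀ i ≤ n, ∀ j ≤ n, y i = y j → i = j := by
    have hex := hper x
    obtain ⟨i₀, hi₀, h⟩ := Nat.find_spec hex
    set J := Nat.find hex with hJ
    obtain ⟨n, hn⟩ : ∃ n, J = n + 1 := ⟨J - 1, by omega⟩
    rw [hn] at h hi₀
    have hlt : ∀ i j, i < j → j ≤ n → y i ≠ y j := fun i j hij hj he =>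
      Nat.find_min hex (m := j) (by omega) ⟨i, hij, he⟩
    refine ⟨n, i₀, lt_of_le_of_ne (by omega) ?_, h.symm, ?_⟩
    · rintro rfl
      exact (hdecl i₀).1.ne h
    · intro i hi j hj he
      rcases lt_trichotomy i j with h' | h' | h'
      · exact (hlt i j h' hj he).elim
      · exact h'
      · exact (hlt j i h' hi he.symm).elim
  set S : Set (Site d) := ⋃ i ∈ Set.Iic n, Set.uIcc (y i) (y (i + 1)) with hS
  have hSfin : S.Finite := (Set.finite_Iic n).biUnion fun i _ => Set.finite_uIcc _ _
  have hseg : ∀ i ≤ n, ∀ w, w ∈ Set.uIcc (y i) (y (i + 1)) → w ∈ S := fun i hi w hw =>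
    Set.mem_biUnion (show i ∈ Set.Iic n from hi) hw
  have hreach : ∀ i, G.Reachable x (y i) := by
    intro i
    induction i with
    | zero => exact SimpleGraph.Reachable.refl _
    | succ i ih => exact ih.trans (BlueSegment.reachable_right (Or.inl (hdecl i)))
  have hSreach : ∀ w ∈ S, G.Reachable x w := by
    intro w hw
    simp only [hS, Set.mem_iUnion] at hw
    obtain ⟨i, -, hw⟩ := hw
    exact (hreach i).trans (BlueSegment.reachable (Or.inl (hdecl i)) hw)
  let H : SimpleGraph (Site d) :=
    { Adj := fun u v => G.Adj u v ∧ ¬(u ∈ S ∧ v ∈ S)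
      symm := ⟨fun _ _ h => ⟨h.1.symm, fun h' => h.2 h'.symm⟩⟩
      loopless := ⟨fun _ h => G.loopless.irrefl _ h.1⟩ }
  -- Even with every edge inside the orbit's segments deleted, an infinite piece hangs off some `z`
  -- in `S`. It then suffices to keep `z` connected to `x` through what survives of `S`.
  obtain ⟨z, hzS, hxz, hzinf⟩ := SimpleGraph.exists_infinite_comp (G := G) (H := H) hSfin
    (fun u v huv hn => by
      by_contra hv
      exact hn ⟨huv, fun h => hv h.2⟩) hinf
  rw [Set.insert_eq_of_mem (hseg 0 (Nat.zero_le _) x Set.left_mem_uIcc)] at hzS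
  have common : ∀ m ≤ n, ∀ δ' : DirConfig d,
      (∀ i < m, δ' (y (i + 1)) = (δ (y i)).rev) → (∀ u, (∀ i ≤ m, u ≠ y i) → δ' u = δ u) →
      (∀ i ≤ m, (blueGraph ω δ').Reachable x (y i)) ∧
      (∀ u v, G.Adj u v → ¬(u ∈ S ∧ v ∈ S) → (blueGraph ω δ').Adj u v) := by
    intro m hm δ' h3 h4
    have hrev : ∀ i < m, Declares ω δ' (y (i + 1)) (y i) := fun i hi => by
      rw [declares_iff, h3 i hi]
      exact Next.rev (hdecl i)
    constructor
    · intro i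
      induction i with
      | zero => exact fun _ => SimpleGraph.Reachable.refl _
      | succ i ih =>
        exact fun hi => (ih (by omega)).trans
          (BlueSegment.reachable_right (Or.inr (hrev i hi)))
    · have hA : ∀ u v, Declares ω δ u v → BlueSegment ω δ' u v ∨ (u = y m ∧ v = y (m + 1)) := by
        intro u v huv
        by_cases hu : ∃ i ≤ m, u = y i
        · obtain ⟨i, hi, rfl⟩ := hu
          have hv : v = y (i + 1) := Next.unique huv (hdecl i)
          subst hv
          rcases Nat.lt_or_ge i m with him | him
          · exact Or.inl (Or.inr (hrev i him))
          · obtain rfl : i = m := le_antisymm hi him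
            exact Or.inr ⟨rfl, rfl⟩
        · push Not at hu
          exact Or.inl (Or.inl (by rw [declares_iff, h4 u hu]; exact huv))
      -- Stopping the reversal at index `m` endangers only the segment from `y m` to `y (m + 1)`.
      have hB : ∀ u v, BlueSegment ω δ u v → BlueSegment ω δ' u v ∨ Set.uIcc u v ⊆ S := by
        rintro u v (huv | huv)
        · rcases hA u v huv with h | ⟨rfl, rfl⟩
          · exact Or.inl h
          · exact Or.inr (hseg m hm)
        · rcases hA v u huv with h | ⟨rfl, rfl⟩
          · exact Or.inl h.symm
          · rw [Set.uIcc_comm]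
            exact Or.inr (hseg m hm)
      rintro u v ⟨h1, p, q, hpq, hu, hv⟩ hn
      rcases hB p q hpq with h | h
      · exact ⟨h1, p, q, h, hu, hv⟩
      · exact absurd ⟨h hu, h hv⟩ hn
  have fin : ∀ δ' : DirConfig d,
      (∀ u v, G.Adj u v → ¬(u ∈ S ∧ v ∈ S) → (blueGraph ω δ').Adj u v) →
      ((G ⊓ blueGraph ω δ').comp z).Infinite ∧
      ∀ u v, G.Adj u v → ¬G.Reachable x u → (blueGraph ω δ').Adj u v := by
    intro δ' h
    refine ⟨hzinf.mono fun v hv => SimpleGraph.Reachable.mono ?_ hv, fun u v huv hu =>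
      h u v huv fun h' => hu (hSreach u h'.1)⟩
    exact fun u v huv => ⟨huv.1, h u v huv.1 huv.2⟩
  -- The endangered segment must not carry `z`. If `z` is on the segment closing the cycle, reversal
  -- stops at `i₀` and that segment remains declared by `y n`; otherwise reversal runs to `n` and
  -- the segment carrying `z` remains blue with its arrow reversed.
  by_cases hz : z ∈ Set.uIcc (y n) (y (n + 1))
  · obtain ⟨δ', h1, h2, h3, h4⟩ := exists_reversal δ y a i₀
      fun i hi j hj => hinj i (by omega) j (by omega)
    obtain ⟨h5, h6⟩ := common i₀ hi₀.le δ' h3 h4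
    have hn : BlueSegment ω δ' (y n) (y (n + 1)) := Or.inl (by
      rw [declares_iff, h4 (y n) fun i hi he => by
        have := hinj n le_rfl i (by omega) he
        omega]
      exact hdecl n)
    refine ⟨δ', z, h1, h2, (fin δ' h6).1, hxz, ?_, (fin δ' h6).2⟩
    refine (h5 i₀ le_rfl).trans ?_
    rw [← hper₀]
    exact hn.reachable_right.symm.trans (hn.reachable hz)
  · obtain ⟨δ', h1, h2, h3, h4⟩ := exists_reversal δ y a n hinj
    obtain ⟨h5, h6⟩ := common n le_rfl δ' h3 h4
    refine ⟨δ', z, h1, h2, (fin δ' h6).1, hxz, ?_, (fin δ' h6).2⟩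
    simp only [hS, Set.mem_iUnion] at hzS
    obtain ⟨i, hi, hzi⟩ := hzS
    have hin : i < n := lt_of_le_of_ne hi (by rintro rfl; exact hz hzi)
    have hb : BlueSegment ω δ' (y i) (y (i + 1)) := Or.inr (by
      rw [declares_iff, h3 i hin]
      exact Next.rev (hdecl i))
    exact (h5 i hi).trans (hb.reachable hzi)

/-- Redirecting one site affects only edges of its own cluster. -/
theorem adj_update_of_not_reachable {ω : SiteConfig d} {δ : DirConfig d} [DecidableEq (Site d)]
    {c : Site d} {a : Direction d} {u v : Site d} (h : (blueGraph ω δ).Adj u v)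
    (hc : ¬(blueGraph ω δ).Reachable c u) :
    (blueGraph ω (Function.update δ c a)).Adj u v := by
  obtain ⟨h1, p, q, hb, hu, hv⟩ := h
  have aux : ∀ p q, Declares ω δ p q → u ∈ Set.uIcc p q →
      Declares ω (Function.update δ c a) p q := by
    intro p q hpq hu
    have hp : p ≠ c := by
      rintro rfl
      exact hc (BlueSegment.reachable (Or.inl hpq) hu)
    rw [declares_iff, Function.update_of_ne hp]
    exact hpq
  refine ⟨h1, p, q, ?_, hu, hv⟩
  rcases hb with hb | hb
  · exact Or.inl (aux p q hb hu)
  · rw [Set.uIcc_comm] at hu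
    exact Or.inr (aux q p hb hu)

/-- Two infinite clusters can be joined by a finite modification of the directions. -/
theorem exists_furcates_succ {ω : SiteConfig d} (hω : Unbounded ω) {v w : Site d}
    (hpath : Relation.ReflTransGen (Feasible ω) v w) {k : ℕ} {x : Site d} (δ : DirConfig d)
    (hper : ∀ δ' : DirConfig d, {x | δ x ≠ δ' x}.Finite → EventuallyPeriodic ω δ')
    (hk : (blueGraph ω δ).Furcates k x) (hxv : (blueGraph ω δ).Reachable x v)
    (hw : ((blueGraph ω δ).comp w).Infinite) (hxw : ¬(blueGraph ω δ).Reachable x w) :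
    ∃ δ' : DirConfig d, {x | δ x ≠ δ' x}.Finite ∧ (blueGraph ω δ').Furcates (k + 1) x := by
  classical
  induction hpath using Relation.ReflTransGen.head_induction_on generalizing δ with
  | refl => exact absurd hxv hxw
  | @head v c hvc _ ih =>
    by_cases hxc : (blueGraph ω δ).Reachable x c
    · exact ih δ hper hk hxc hw hxw
    have hcx : ¬(blueGraph ω δ).Reachable c x := fun h => hxc h.symm
    obtain ⟨a, ha⟩ := hvc.symm.exists_next
    -- If the new cluster is infinite, freeing `c` and pointing it at `v` already supplies the extra
    -- piece. If it is finite, redirecting `c` damages only finite material; the target cluster is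
    -- then reached, or the chain continues with `c` attached to the cluster of `x`.
    by_cases hc : ((blueGraph ω δ).comp c).Infinite
    · obtain ⟨δ', z, h1, h2, h3, h4, h5, h6⟩ :=
        exists_freeing hω (hper δ (by simp)) hvc.2.1 hc a
      obtain ⟨W, hW, hag⟩ := exists_agreeOff ω h1
      have hE : ∀ u, (blueGraph ω δ).Reachable x u → (blueGraph ω δ').Reachable x u :=
        fun u hu => (SimpleGraph.Reachable.inf_of_intact h6 hcx hu).mono inf_le_right
      exact ⟨δ', h1, hk.succ hW hag hE h3 (fun h => hxc (h.trans h4.symm))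
        ((hE v hxv).trans ((ha.blueSegment h2).reachable_right.symm.trans h5))⟩
    · have h1 : {x | δ x ≠ Function.update δ c a x}.Finite := by
        refine (Set.finite_singleton c).subset fun u hu => ?_
        by_contra hne
        exact hu (Function.update_of_ne hne _ _).symm
      obtain ⟨W, hW, hag⟩ := exists_agreeOff ω h1
      have hE : ∀ u, (blueGraph ω δ).Reachable x u →
          (blueGraph ω (Function.update δ c a)).Reachable x u := fun u hu =>
        (SimpleGraph.Reachable.inf_of_intact (fun _ _ => adj_update_of_not_reachable)
          hcx hu).mono inf_le_right
      have hcw : ¬(blueGraph ω δ).Reachable c w := fun h => hc (h.comp_eq ▸ hw)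
      have hw' : ((blueGraph ω δ ⊓ blueGraph ω (Function.update δ c a)).comp w).Infinite :=
        hw.mono fun u hu => SimpleGraph.Reachable.inf_of_intact
          (fun _ _ => adj_update_of_not_reachable) hcw hu
      by_cases hxw' : (blueGraph ω (Function.update δ c a)).Reachable x w
      · exact ⟨_, h1, hk.succ hW hag hE hw' hxw hxw'⟩
      · obtain ⟨δ'', h7, h8⟩ := ih (Function.update δ c a)
          (fun δ'' h => hper δ'' (finite_ne_trans h1 h)) (hk.of_agreeOff hW hag hE)
          ((hE v hxv).trans (ha.blueSegment (by simp)).reachable_right.symm)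
          (hw'.mono fun u hu => SimpleGraph.Reachable.mono inf_le_right hu) hxw'
        exact ⟨δ'', finite_ne_trans h1 h7, h8⟩

/-- There are at least two infinite clusters. -/
def TwoInfinite (ω : SiteConfig d) (δ : DirConfig d) : Prop :=
  ∃ x y, ((blueGraph ω δ).comp x).Infinite ∧ ((blueGraph ω δ).comp y).Infinite ∧
    ¬(blueGraph ω δ).Reachable x y

theorem TwoInfinite.exists_other {ω : SiteConfig d} {δ : DirConfig d} (h : TwoInfinite ω δ)
    (x : Site d) : ∃ w, ω w = true ∧ ((blueGraph ω δ).comp w).Infinite ∧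
      ¬(blueGraph ω δ).Reachable x w := by
  obtain ⟨y, z, hy, hz, hyz⟩ := h
  have aux : ∀ y, ((blueGraph ω δ).comp y).Infinite → ¬(blueGraph ω δ).Reachable x y →
      ∃ w, ω w = true ∧ ((blueGraph ω δ).comp w).Infinite ∧
        ¬(blueGraph ω δ).Reachable x w := by
    intro y hy hxy
    obtain ⟨w, hw, hyw⟩ := exists_occupied_of_infinite hy
    exact ⟨w, hw, hyw.comp_eq ▸ hy, fun h => hxy (h.trans hyw.symm)⟩
  by_cases hxy : (blueGraph ω δ).Reachable x y
  · exact aux z hz fun h => hyz (hxy.symm.trans h)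
  · exact aux y hy hxy

/-- If two infinite clusters persist under finite modifications, then some finite modification
yields a trifurcation. -/
theorem exists_trifurcation {ω : SiteConfig d} (hω : Unbounded ω)
    (hconn : ∀ u v, ω u = true → ω v = true → Relation.ReflTransGen (Feasible ω) u v)
    {δ : DirConfig d}
    (hper : ∀ δ' : DirConfig d, {x | δ x ≠ δ' x}.Finite → EventuallyPeriodic ω δ')
    (htwo : ∀ δ' : DirConfig d, {x | δ x ≠ δ' x}.Finite → TwoInfinite ω δ') :
    ∃ δ' : DirConfig d, {x | δ x ≠ δ' x}.Finite ∧ ∃ (K : Finset (Site d)) (y : Fin 3 → Site d),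
      K.Nonempty ∧ (blueGraph ω δ').Trifurcation K y := by
  have step : ∀ k x (δ₁ : DirConfig d), {x | δ x ≠ δ₁ x}.Finite →
      (blueGraph ω δ₁).Furcates (k + 1) x →
      ∃ δ' : DirConfig d, {x | δ x ≠ δ' x}.Finite ∧ (blueGraph ω δ').Furcates (k + 2) x := by
    intro k x δ₁ h1 hk
    obtain ⟨v, hv, hxv⟩ := exists_occupied_of_infinite hk.infinite
    obtain ⟨w, hw, hw', hxw⟩ := (htwo δ₁ h1).exists_other x
    obtain ⟨δ', h2, h3⟩ := exists_furcates_succ hω (hconn v w hv hw) δ₁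
      (fun δ' h => hper δ' (finite_ne_trans h1 h)) hk hxv hw' hxw
    exact ⟨δ', finite_ne_trans h1 h2, h3⟩
  obtain ⟨x, -, hx, -⟩ := htwo δ (by simp)
  obtain ⟨δ₁, h1, h2⟩ := step 0 x δ (by simp) (SimpleGraph.furcates_one hx)
  obtain ⟨δ₂, h3, h4⟩ := step 1 x δ₁ h1 h2
  obtain ⟨K, y, hK, hy⟩ := h4.exists_trifurcation (finite_setOf_adj ω δ₂)
  exact ⟨δ₂, h3, K, y, ⟨x, hK⟩, hy⟩

end OneChoice

/-! ### Chains of feasible pairs between occupied sites. -/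

namespace OneChoice

variable {d : ℕ}

theorem add_smul_vec_injective (u : Site d) (a : Direction d) {m n : ℕ}
    (h : u + m • a.vec = u + n • a.vec) : m = n := by
  have := congrFun h a.1
  rw [add_smul_vec_apply_self, add_smul_vec_apply_self] at this
  split_ifs at this <;> omega

/-- Occupied sites on a line are linked by feasible pairs. -/
theorem Unbounded.reflTransGen_add_smul {ω : SiteConfig d} (h : Unbounded ω) (a : Direction d)
    (n : ℕ) : ∀ u, ω u = true → ω (u + n • a.vec) = true →
      Relation.ReflTransGen (Feasible ω) u (u + n • a.vec) := by
  induction n using Nat.strong_induction_on with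
  | _ n ih =>
    intro u hu hv
    rcases Nat.eq_zero_or_pos n with rfl | hn
    · simpa using Relation.ReflTransGen.refl
    obtain ⟨w, hw⟩ := h.exists_next hu a
    obtain ⟨hf, m, rfl⟩ := hw
    have hm0 : m ≠ 0 := by
      rintro rfl
      exact hf.ne (by simp)
    have hmn : m ≤ n := by
      by_contra hlt
      rcases hf.2.2.2 _ (mem_uIcc_add_smul u a (not_le.1 hlt).le) hv with h1 | h1
      · have := add_smul_vec_injective u a (m := n) (n := 0) (by simpa using h1)
        omega
      · have := add_smul_vec_injective u a h1
        omega
    have heq : u + n • a.vec = (u + m • a.vec) + (n - m) • a.vec := by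
      rw [add_assoc, ← add_smul, Nat.add_sub_cancel' hmn]
    rw [heq] at hv ⊢
    exact Relation.ReflTransGen.head hf (ih (n - m) (by omega) _ hf.2.1 hv)

theorem Unbounded.reflTransGen_add_single {ω : SiteConfig d} (h : Unbounded ω) (i : Fin d)
    (c : ℤ) (u : Site d) (hu : ω u = true) (hv : ω (u + Pi.single i c) = true) :
    Relation.ReflTransGen (Feasible ω) u (u + Pi.single i c) := by
  obtain ⟨n, rfl | rfl⟩ := c.eq_nat_or_neg
  · have heq : (Pi.single i (n : ℤ) : Site d) = n • Direction.vec (i, true) := by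
      simp [Direction.vec, ← Pi.single_smul]
    rw [heq] at hv ⊢
    exact h.reflTransGen_add_smul _ n u hu hv
  · have heq : (Pi.single i (-n : ℤ) : Site d) = n • Direction.vec (i, false) := by
      simp [Direction.vec, ← Pi.single_smul]
    rw [heq] at hv ⊢
    exact h.reflTransGen_add_smul _ n u hu hv

/-- Any two parallel lines in the first direction are joined by a segment with occupied ends. -/
def Crossing [NeZero d] (ω : SiteConfig d) : Prop :=
  ∀ (x : Site d) (j : Fin d) (c : ℤ), ∃ n : ℕ, ω (x + n • Direction.vec (0, true)) = true ∧
    ω (x + n • Direction.vec (0, true) + Pi.single j c) = true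

/-- Any two occupied sites are linked by feasible pairs. -/
theorem Crossing.reflTransGen_feasible [NeZero d] {ω : SiteConfig d} (hω : Unbounded ω)
    (hc : Crossing ω) {u v : Site d} (hu : ω u = true) (hv : ω v = true) :
    Relation.ReflTransGen (Feasible ω) u v := by
  classical
  have hsmul : ∀ n : ℕ, (n • Direction.vec (0, true) : Site d) = Pi.single 0 (n : ℤ) := fun n => by
    simp [Direction.vec, ← Pi.single_smul]
  -- A relation between the lines through `x` and `y` in direction 0, so that the points themselves
  -- need not be occupied. Transitivity needs an occupied site on the middle line, which `Unbounded`
  -- provides.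
  let R : Site d → Site d → Prop := fun x y => ∀ b c : ℤ, ω (x + Pi.single 0 b) = true →
    ω (y + Pi.single 0 c) = true →
      Relation.ReflTransGen (Feasible ω) (x + Pi.single 0 b) (y + Pi.single 0 c)
  have line : ∀ (x : Site d) (b c : ℤ), ω (x + Pi.single 0 b) = true →
      ω (x + Pi.single 0 c) = true →
      Relation.ReflTransGen (Feasible ω) (x + Pi.single 0 b) (x + Pi.single 0 c) := by
    intro x b c hb hc
    have heq : x + Pi.single 0 c = (x + Pi.single 0 b) + Pi.single 0 (c - b) := by
      rw [add_assoc, ← Pi.single_add, add_sub_cancel]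
    rw [heq] at hc ⊢
    exact hω.reflTransGen_add_single 0 (c - b) _ hb hc
  have step : ∀ (x : Site d) (j : Fin d) (e : ℤ), R x (x + Pi.single j e) := by
    intro x j e b c hb hc'
    obtain ⟨n, h1, h2⟩ := hc x j e
    rw [hsmul] at h1 h2
    have h3 := (line x b n hb h1).trans (hω.reflTransGen_add_single j e _ h1 h2)
    rw [add_right_comm] at h3 h2
    exact h3.trans (line _ _ _ h2 hc')
  have trans : ∀ x y z, R x y → R y z → R x z := by
    intro x y z h1 h2 b c hb hc'
    obtain ⟨n, -, hn⟩ := hω y (0, true)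
    rw [hsmul] at hn
    exact (h1 b n hb hn).trans (h2 n c hn hc')
  -- The coordinates of `u` are replaced by those of `v` one at a time.
  have all : ∀ s : Finset (Fin d), R u (s.piecewise v u) := by
    intro s
    induction s using Finset.induction_on with
    | empty =>
      intro b c
      rw [Finset.piecewise_empty]
      exact line u b c
    | insert j s hj ih =>
      refine trans _ _ _ ih ?_
      have heq : (insert j s).piecewise v u =
          s.piecewise v u + Pi.single j (v j - s.piecewise v u j) := by
        rw [Finset.piecewise_insert]
        funext i
        by_cases hi : i = j
        · subst hi
          simp
        · simp [hi]
      rw [heq]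
      exact step _ _ _
  have := all Finset.univ 0 0
  simp only [Finset.piecewise_univ, Pi.single_zero, add_zero] at this
  exact this hu hv

end OneChoice

/-! ### Ergodicity from mixing on a π-system, and recurrence. -/

section Ergodic

open Filter Topology

variable {α : Type*} [mα : MeasurableSpace α] {μ : Measure α} [IsProbabilityMeasure μ]

/-- A transformation that mixes a generating `π`-system mixes each of its members with every
measurable set. -/
theorem MeasureTheory.MeasurePreserving.tendsto_measureReal_inter_preimage {T : α → α}
    (hT : MeasurePreserving T μ μ) {S : Set (Set α)} (hS : IsPiSystem S)
    (hgen : mα = MeasurableSpace.generateFrom S) {A : Set α} (hA : A ∈ S)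
    (hmix : ∀ B ∈ S, ∀ᶠ n in atTop, μ.real (A ∩ T^[n] ⁻¹' B) = μ.real A * μ.real B)
    {B : Set α} (hB : MeasurableSet B) :
    Tendsto (fun n => μ.real (A ∩ T^[n] ⁻¹' B)) atTop (𝓝 (μ.real A * μ.real B)) := by
  have hTn : ∀ n, MeasurePreserving T^[n] μ μ := fun n => hT.iterate n
  have hAm : MeasurableSet A := by
    rw [hgen]
    exact MeasurableSpace.measurableSet_generateFrom hA
  induction B, hB using MeasurableSpace.induction_on_inter hgen hS with
  | empty => simp
  | basic B hB => exact tendsto_const_nhds.congr' (EventuallyEq.symm (hmix B hB))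
  | compl B hB ih =>
    have h1 : ∀ n, μ.real (A ∩ T^[n] ⁻¹' Bᶜ) = μ.real A - μ.real (A ∩ T^[n] ⁻¹' B) := by
      intro n
      have := measureReal_inter_add_sdiff (μ := μ) (s := A) ((hTn n).measurable hB)
      rw [Set.preimage_compl, ← Set.sdiff_eq]
      linarith
    simp only [h1, probReal_compl_eq_one_sub hB, mul_sub, mul_one]
    exact tendsto_const_nhds.sub ih
  | iUnion f hd hf ih =>
    have h1 : ∀ n, μ.real (A ∩ T^[n] ⁻¹' ⋃ i, f i) = ∑' i, μ.real (A ∩ T^[n] ⁻¹' f i) := by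
      intro n
      rw [Set.preimage_iUnion, Set.inter_iUnion, measureReal_def, measure_iUnion,
        ENNReal.tsum_toReal_eq (fun i => measure_ne_top _ _)]
      · rfl
      · intro i j hij
        exact ((hd hij).preimage _).mono Set.inter_subset_right Set.inter_subset_right
      · exact fun i => hAm.inter ((hTn n).measurable (hf i))
    have h2 : μ.real (⋃ i, f i) = ∑' i, μ.real (f i) := by
      rw [measureReal_def, measure_iUnion hd hf,
        ENNReal.tsum_toReal_eq (fun i => measure_ne_top _ _)]
      rfl
    have h3 : Summable fun i => μ.real (f i) := by
      refine ENNReal.summable_toReal ?_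
      rw [← measure_iUnion hd hf]
      exact measure_ne_top _ _
    simp only [h1, h2, ← tsum_mul_left]
    refine tendsto_tsum_of_dominated_convergence h3 ih (Eventually.of_forall fun n i => ?_)
    rw [Real.norm_of_nonneg measureReal_nonneg]
    refine (measureReal_mono Set.inter_subset_right).trans (le_of_eq ?_)
    exact (hTn n).measureReal_preimage (hf i).nullMeasurableSet

/-- A transformation that mixes a generating `π`-system is ergodic. -/
theorem MeasureTheory.MeasurePreserving.ergodic_of_mixing {T : α → α}
    (hT : MeasurePreserving T μ μ) {S : Set (Set α)} (hS : IsPiSystem S)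
    (hgen : mα = MeasurableSpace.generateFrom S)
    (hmix : ∀ A ∈ S, ∀ B ∈ S, ∀ᶠ n in atTop,
      μ.real (A ∩ T^[n] ⁻¹' B) = μ.real A * μ.real B) : Ergodic T μ := by
  refine ⟨hT, ⟨fun B hB hTB => ?_⟩⟩
  have hTn : ∀ n, T^[n] ⁻¹' B = B := fun n => Function.IsFixedPt.preimage_iterate hTB n
  -- For an invariant `B` the mixing sequence is constant, hence equal to its limit. Extending from
  -- the π-system makes `B` independent of itself.
  have h1 : ∀ A ∈ S, μ.real (A ∩ B) = μ.real A * μ.real B := fun A hA => by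
    have := hT.tendsto_measureReal_inter_preimage hS hgen hA (hmix A hA) hB
    simp only [hTn] at this
    exact tendsto_nhds_unique tendsto_const_nhds this
  have h2 : μ.restrict B = μ B • μ := by
    refine ext_of_generate_finite S hgen hS (fun A hA => ?_) (by simp)
    have hAm : MeasurableSet A := by
      rw [hgen]
      exact MeasurableSpace.measurableSet_generateFrom hA
    rw [Measure.restrict_apply hAm, Measure.smul_apply, smul_eq_mul, mul_comm,
      ← ENNReal.toReal_eq_toReal_iff' (measure_ne_top _ _) (by finiteness), ENNReal.toReal_mul]
    exact h1 A hA
  have h3 : μ B = μ B * μ B := by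
    have := congrArg (fun ν => ν B) h2
    simpa [Measure.restrict_apply hB] using this
  rw [eventuallyConst_set']
  have h4 : μ B = 0 ∨ μ B = 1 := by
    by_cases h0 : μ B = 0
    · exact Or.inl h0
    · right
      have := (ENNReal.mul_right_inj h0 (measure_ne_top μ B)).1
        ((mul_one (μ B)).trans h3)
      exact this.symm
  rcases h4 with h4 | h4
  · exact Or.inl (by simpa using h4)
  · right
    rw [ae_eq_univ]
    rwa [prob_compl_eq_zero_iff hB]

/-- Under an ergodic map, almost every orbit visits a set of positive measure infinitely often. -/
theorem Ergodic.ae_frequently_mem {T : α → α} (hT : Ergodic T μ) {s : Set α}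
    (hs : MeasurableSet s) (h0 : μ s ≠ 0) : ∀ᵐ x ∂μ, ∃ᶠ n in atTop, T^[n] x ∈ s := by
  have hmeas : MeasurableSet {x | ∃ᶠ n in atTop, T^[n] x ∈ s} := by
    simp only [frequently_atTop]
    have h1 : ∀ b, MeasurableSet {x | T^[b] x ∈ s} := fun b => (hT.measurable.iterate b) hs
    measurability
  have hinv : T ⁻¹' {x | ∃ᶠ n in atTop, T^[n] x ∈ s} = {x | ∃ᶠ n in atTop, T^[n] x ∈ s} := by
    ext x
    simp only [Set.mem_preimage, Set.mem_ofPred_eq, ← Function.iterate_succ_apply]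
    have h1 := frequently_map (f := atTop) (m := fun n : ℕ => n + 1) (P := fun n => T^[n] x ∈ s)
    rw [map_add_atTop_eq_nat 1] at h1
    exact h1.symm
  rcases hT.toPreErgodic.ae_mem_or_ae_notMem hmeas hinv with h | h
  · exact h
  · exfalso
    -- Poincaré recurrence: almost every point of `s` returns infinitely often, so the invariant
    -- event cannot be null when `s` is not.
    have hc := hT.toMeasurePreserving.conservative.ae_mem_imp_frequently_image_mem
      hs.nullMeasurableSet
    refine h0 (measure_eq_zero_iff_ae_notMem.2 ?_)
    filter_upwards [h, hc] with x hx hx' hxs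
    exact hx (hx' hxs)

end Ergodic

/-! ### Ergodicity of lattice translations. -/

namespace OneChoice

variable {d : ℕ}

/-- Translation of a configuration. -/
def shift {X : Type*} (v : Site d) (f : Site d → X) : Site d → X := fun x => f (x + v)

theorem shift_iterate {X : Type*} (v : Site d) (n : ℕ) :
    (shift v : (Site d → X) → Site d → X)^[n] = shift (n • v) := by
  induction n with
  | zero => funext f x; simp [shift]
  | succ n ih =>
    rw [Function.iterate_succ', ih]
    funext f x
    simp only [Function.comp, shift, succ_nsmul]
    congr 1
    abel

theorem measurable_shift {X : Type*} [MeasurableSpace X] (v : Site d) :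
    Measurable (shift v : (Site d → X) → Site d → X) :=
  measurable_pi_lambda _ fun _ => measurable_pi_apply _

theorem eventually_disjoint_translate {v : Site d} (hv : v ≠ 0) (s s' : Finset (Site d)) :
    ∀ᶠ n : ℕ in Filter.atTop, ∀ x ∈ s', x + n • v ∉ s := by
  rw [← Nat.cofinite_eq_atTop, Filter.eventually_all_finset]
  intro x _
  have : {n : ℕ | x + n • v ∈ s}.Finite := by
    refine Set.Finite.preimage (f := fun n : ℕ => x + n • v) ?_ s.finite_toSet
    intro m _ n _ h
    have h' : m • v = n • v := add_left_cancel h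
    obtain ⟨i, hi⟩ := Function.ne_iff.1 hv
    have := congrFun h' i
    simp only [Pi.smul_apply, nsmul_eq_mul] at this
    exact_mod_cast mul_right_cancel₀ hi this
  exact this.eventually_cofinite_notMem

section Product

variable {X : Type*} [MeasurableSpace X] (ν : Measure X) [IsProbabilityMeasure ν]

/-- With disjoint windows the intersection is a single cylinder over their union, whose measure
factors. Empty `s` gives invariance; distant windows give mixing. -/
theorem infinitePi_inter_preimage_shift {s s' : Finset (Site d)} {t t' : Site d → Set X}
    (ht : ∀ x, MeasurableSet (t x)) (ht' : ∀ x, MeasurableSet (t' x)) {w : Site d}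
    (hd : ∀ x ∈ s', x + w ∉ s) :
    Measure.infinitePi (fun _ : Site d => ν) ((s : Set (Site d)).pi t ∩
        shift w ⁻¹' (s' : Set (Site d)).pi t') =
      (∏ x ∈ s, ν (t x)) * ∏ x ∈ s', ν (t' x) := by
  classical
  have heq : (s : Set (Site d)).pi t ∩ shift w ⁻¹' (s' : Set (Site d)).pi t' =
      ((s ∪ s'.map (addRightEmbedding w) : Finset (Site d)) : Set (Site d)).pi
        (fun x => if x ∈ s then t x else t' (x - w)) := by
    ext f
    simp only [Set.mem_inter_iff, Set.mem_preimage, Set.mem_pi, Finset.mem_coe, shift]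
    constructor
    · rintro ⟨h1, h2⟩ x hx
      by_cases hxs : x ∈ s
      · rw [if_pos hxs]
        exact h1 x hxs
      · rw [if_neg hxs]
        obtain ⟨y, hy, rfl⟩ := Finset.mem_map.1 ((Finset.mem_union.1 hx).resolve_left hxs)
        simpa using h2 y hy
    · intro h
      refine ⟨fun x hx => ?_, fun x hx => ?_⟩
      · have := h x (Finset.mem_union_left _ hx)
        rwa [if_pos hx] at this
      · have := h (x + w) (Finset.mem_union_right _ (Finset.mem_map_of_mem _ hx))
        rw [if_neg (hd x hx)] at this
        simpa using this
  have hdisj : Disjoint s (s'.map (addRightEmbedding w)) := by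
    rw [Finset.disjoint_right]
    intro x hx
    obtain ⟨y, hy, rfl⟩ := Finset.mem_map.1 hx
    exact hd y hy
  rw [heq, Measure.infinitePi_pi, Finset.prod_union hdisj, Finset.prod_map]
  · congr 1
    · exact Finset.prod_congr rfl fun x hx => by rw [if_pos hx]
    · refine Finset.prod_congr rfl fun x hx => ?_
      rw [addRightEmbedding_apply, if_neg (hd x hx), add_sub_cancel_right]
  · intro x _
    split_ifs
    · exact ht x
    · exact ht' _

theorem measurePreserving_shift (v : Site d) :
    MeasurePreserving (shift v) (Measure.infinitePi fun _ : Site d => ν)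
      (Measure.infinitePi fun _ : Site d => ν) := by
  refine ⟨measurable_shift v, Measure.eq_infinitePi _ fun s t ht => ?_⟩
  rw [Measure.map_apply (measurable_shift v) (.pi s.countable_toSet fun _ _ => ht _)]
  have := infinitePi_inter_preimage_shift ν (s := ∅) (s' := s) (t := t) (t' := t) (w := v) ht ht
    (by simp)
  simpa using this

end Product

variable (p : unitInterval)

instance : IsProbabilityMeasure (siteMeasure d p) := by
  unfold siteMeasure
  infer_instance

variable [NeZero d]

instance : IsProbabilityMeasure (dirMeasure d) := by
  unfold dirMeasure
  infer_instance

instance : IsProbabilityMeasure (oneChoiceMeasure d p) := by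
  unfold oneChoiceMeasure
  infer_instance

/-- Translation of the occupied sites and of the directions. -/
def shiftConfig (v : Site d) : SiteConfig d × DirConfig d → SiteConfig d × DirConfig d :=
  Prod.map (shift v) (shift v)

theorem measurePreserving_shiftConfig (v : Site d) :
    MeasurePreserving (shiftConfig v) (oneChoiceMeasure d p) (oneChoiceMeasure d p) :=
  (measurePreserving_shift _ v).prod (measurePreserving_shift _ v)

/-- Translations are ergodic. -/
theorem ergodic_shiftConfig {v : Site d} (hv : v ≠ 0) :
    Ergodic (shiftConfig v) (oneChoiceMeasure d p) := by
  set S₁ := squareCylinders fun _ : Site d => {s : Set Bool | MeasurableSet s}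
  set S₂ := squareCylinders fun _ : Site d => {s : Set (Direction d) | MeasurableSet s}
  have hpi₁ : IsPiSystem S₁ := isPiSystem_squareCylinders
    (fun _ => MeasurableSpace.isPiSystem_measurableSet) fun _ => by simp
  have hpi₂ : IsPiSystem S₂ := isPiSystem_squareCylinders
    (fun _ => MeasurableSpace.isPiSystem_measurableSet) fun _ => by simp
  have hu₁ : Set.univ ∈ S₁ := ⟨∅, fun _ => Set.univ, by simp, by simp⟩
  have hu₂ : Set.univ ∈ S₂ := ⟨∅, fun _ => Set.univ, by simp, by simp⟩
  refine (measurePreserving_shiftConfig p v).ergodic_of_mixing (hpi₁.prod hpi₂) ?_ ?_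
  · exact (generateFrom_eq_prod generateFrom_squareCylinders generateFrom_squareCylinders
      ⟨fun _ => Set.univ, fun _ => hu₁, Set.iUnion_const _⟩
      ⟨fun _ => Set.univ, fun _ => hu₂, Set.iUnion_const _⟩).symm
  · rintro _ ⟨_, ⟨s₁, t₁, ht₁, rfl⟩, _, ⟨s₂, t₂, ht₂, rfl⟩, rfl⟩
      _ ⟨_, ⟨s₁', t₁', ht₁', rfl⟩, _, ⟨s₂', t₂', ht₂', rfl⟩, rfl⟩
    filter_upwards [eventually_disjoint_translate hv s₁ s₁', eventually_disjoint_translate hv s₂ s₂']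
      with n hn₁ hn₂
    have ht : ∀ {Y : Type} [MeasurableSpace Y] {t : Site d → Set Y},
        t ∈ Set.univ.pi (fun _ => {s : Set Y | MeasurableSet s}) → ∀ x, MeasurableSet (t x) :=
      fun h x => h x trivial
    rw [shiftConfig, Prod.map_iterate, shift_iterate, shift_iterate]
    simp only [measureReal_def]
    rw [← ENNReal.toReal_mul]
    congr 1
    rw [show Prod.map (shift (n • v)) (shift (n • v)) ⁻¹'
        (s₁' : Set (Site d)).pi t₁' ×ˢ (s₂' : Set (Site d)).pi t₂' =
        (shift (n • v) ⁻¹' (s₁' : Set (Site d)).pi t₁') ×ˢ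
          (shift (n • v) ⁻¹' (s₂' : Set (Site d)).pi t₂') from rfl, Set.prod_inter_prod, oneChoiceMeasure, Measure.prod_prod, Measure.prod_prod,
      Measure.prod_prod, siteMeasure, dirMeasure,
      infinitePi_inter_preimage_shift _ (ht ht₁) (ht ht₁') hn₁,
      infinitePi_inter_preimage_shift _ (ht ht₂) (ht ht₂') hn₂,
      Measure.infinitePi_pi _ fun x _ => ht ht₁ x, Measure.infinitePi_pi _ fun x _ => ht ht₁' x,
      Measure.infinitePi_pi _ fun x _ => ht ht₂ x, Measure.infinitePi_pi _ fun x _ => ht ht₂' x]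
    ring

end OneChoice

/-! ### Finite modifications of directions preserve null sets. -/

namespace OneChoice

open Filter Topology ENNReal

variable {d : ℕ} [NeZero d] (p : unitInterval)

open Classical in
/-- Redirect the site `x` in direction `a`. -/
noncomputable def redirect (x : Site d) (a : Direction d) (c : SiteConfig d × DirConfig d) :
    SiteConfig d × DirConfig d :=
  (c.1, Function.update c.2 x a)

omit [NeZero d] in
theorem measurable_redirect (x : Site d) (a : Direction d) : Measurable (redirect x a) := by
  classical
  refine measurable_fst.prodMk ?_
  refine measurable_pi_lambda _ fun y => ?_
  by_cases h : y = x
  · subst h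
    simp
  · simp only [Function.update_of_ne h]
    fun_prop

omit [NeZero d] in
theorem redirect_self (x : Site d) {a : Direction d} {c : SiteConfig d × DirConfig d}
    (h : c.2 x = a) : redirect x a c = c := by
  subst h
  simp [redirect]

omit [NeZero d] in
theorem measurableSet_dir (x : Site d) (a : Direction d) :
    MeasurableSet {c : SiteConfig d × DirConfig d | c.2 x = a} :=
  measurableSet_eq_fun (by fun_prop) measurable_const

theorem map_uniformOfFintype_perm {α : Type*} [Fintype α] [Nonempty α] [MeasurableSpace α]
    [MeasurableSingletonClass α] (σ : Equiv.Perm α) :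
    (PMF.uniformOfFintype α).toMeasure.map σ = (PMF.uniformOfFintype α).toMeasure := by
  refine Measure.ext_of_singleton fun a => ?_
  rw [Measure.map_apply (measurable_of_finite _) (measurableSet_singleton a),
    ← Equiv.image_symm_eq_preimage, Set.image_singleton,
    PMF.toMeasure_apply_singleton _ _ (measurableSet_singleton _),
    PMF.toMeasure_apply_singleton _ _ (measurableSet_singleton _)]
  simp

open Classical in
/-- Apply a permutation to the direction of the site `x`. -/
noncomputable def permuteDir (x : Site d) (σ : Equiv.Perm (Direction d))
    (c : SiteConfig d × DirConfig d) : SiteConfig d × DirConfig d :=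
  (c.1, fun y => (if y = x then σ else Equiv.refl _) (c.2 y))

omit [NeZero d] in
theorem permuteDir_eq_redirect (x : Site d) (σ : Equiv.Perm (Direction d))
    (c : SiteConfig d × DirConfig d) : permuteDir x σ c = redirect x (σ (c.2 x)) c := by
  classical
  refine Prod.ext rfl ?_
  funext y
  by_cases h : y = x
  · subst h
    simp [permuteDir, redirect]
  · simp [permuteDir, redirect, h]

theorem measurePreserving_permuteDir (x : Site d) (σ : Equiv.Perm (Direction d)) :
    MeasurePreserving (permuteDir x σ) (oneChoiceMeasure d p) (oneChoiceMeasure d p) := by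
  classical
  have hf : ∀ y : Site d, Measurable
      ((if y = x then σ else Equiv.refl _ : Equiv.Perm (Direction d)) : Direction d → Direction d) :=
    fun y => measurable_of_finite _
  refine (MeasurePreserving.id _).prod (g := fun (δ : DirConfig d) y =>
    (if y = x then σ else Equiv.refl _ : Equiv.Perm (Direction d)) (δ y)) ⟨by fun_prop, ?_⟩
  unfold dirMeasure
  rw [Measure.infinitePi_map_pi _ hf]
  simp only [map_uniformOfFintype_perm]

/-- The direction of a site is uniform and independent of everything else. -/
theorem measure_inter_dir (x : Site d) (a : Direction d) {S : Set (SiteConfig d × DirConfig d)}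
    (hS : MeasurableSet S) (hinv : ∀ c ∈ S, ∀ b, redirect x b c ∈ S) :
    (Fintype.card (Direction d)) * oneChoiceMeasure d p (S ∩ {c | c.2 x = a}) =
      oneChoiceMeasure d p S := by
  classical
  have h1 : ∀ b, oneChoiceMeasure d p (S ∩ {c | c.2 x = b}) =
      oneChoiceMeasure d p (S ∩ {c | c.2 x = a}) := by
    intro b
    -- Swapping `a` and `b` at `x` preserves the law and fixes `S`, so all values of the direction
    -- at `x` split `S` into parts of equal measure.
    rw [← (measurePreserving_permuteDir p x (Equiv.swap a b)).measure_preimage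
      (hS.inter (measurableSet_dir x b)).nullMeasurableSet]
    congr 1
    ext c
    have h2 : permuteDir x (Equiv.swap a b) c ∈ S ↔ c ∈ S := by
      rw [permuteDir_eq_redirect]
      refine ⟨fun h => ?_, fun h => hinv c h _⟩
      have := hinv _ h (c.2 x)
      simpa [redirect] using this
    have h3 : (permuteDir x (Equiv.swap a b) c).2 x = b ↔ c.2 x = a := by
      simp [permuteDir, Equiv.swap_apply_eq_iff]
    simp only [Set.mem_preimage, Set.mem_inter_iff, h2, Set.mem_ofPred_eq, h3]
  have h2 : S = ⋃ b : Direction d, S ∩ {c | c.2 x = b} := by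
    ext c
    simp
  conv_rhs => rw [h2, measure_iUnion (fun b b' hb => Set.disjoint_left.2 fun c hc hc' =>
    hb (hc.2.symm.trans hc'.2)) fun b => hS.inter (measurableSet_dir x b)]
  simp only [h1, tsum_fintype, Finset.sum_const, nsmul_eq_mul, Finset.card_univ]

/-- The preimage of a null set does not depend on the direction at `x`, so its measure is 2d times
that of its part where this direction is already `a`. There the map is the identity, and that part
lies in the null set. -/
theorem quasiMeasurePreserving_redirect (x : Site d) (a : Direction d) :
    Measure.QuasiMeasurePreserving (redirect x a) (oneChoiceMeasure d p)
      (oneChoiceMeasure d p) := by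
  refine ⟨measurable_redirect x a, Measure.AbsolutelyContinuous.mk fun S hS h0 => ?_⟩
  rw [Measure.map_apply (measurable_redirect x a) hS,
    ← measure_inter_dir p x a (measurable_redirect x a hS) fun c hc b => by
      simpa [redirect] using hc]
  refine mul_eq_zero_of_right _ (measure_mono_null ?_ h0)
  rintro c ⟨hc, hc'⟩
  rwa [Set.mem_preimage, redirect_self x hc'] at hc

/-- Redirect finitely many sites. -/
noncomputable def redirectList (l : List (Site d × Direction d))
    (c : SiteConfig d × DirConfig d) : SiteConfig d × DirConfig d :=
  l.foldr (fun q c => redirect q.1 q.2 c) c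

theorem quasiMeasurePreserving_redirectList (l : List (Site d × Direction d)) :
    Measure.QuasiMeasurePreserving (redirectList l) (oneChoiceMeasure d p)
      (oneChoiceMeasure d p) := by
  induction l with
  | nil => exact Measure.QuasiMeasurePreserving.id _
  | cons q l ih => exact (quasiMeasurePreserving_redirect p q.1 q.2).comp ih

omit [NeZero d] in
theorem exists_redirectList (ω : SiteConfig d) {δ δ' : DirConfig d}
    (h : {x | δ x ≠ δ' x}.Finite) : ∃ l, redirectList l (ω, δ) = (ω, δ') := by
  classical
  have main : ∀ s : Set (Site d), s.Finite → ∀ δ' : DirConfig d, {x | δ x ≠ δ' x} ⊆ s →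
      ∃ l, redirectList l (ω, δ) = (ω, δ') := by
    intro s hs
    induction s, hs using Set.Finite.induction_on with
    | empty =>
      intro δ' h
      refine ⟨[], ?_⟩
      have : δ = δ' := by
        funext x
        by_contra hx
        exact h hx
      rw [this]
      rfl
    | @insert x s _ _ ih =>
      intro δ' h
      obtain ⟨l, hl⟩ := ih (Function.update δ' x (δ x)) (by
        intro y hy
        by_cases hyx : y = x
        · subst hyx
          simp at hy
        · rw [Set.mem_ofPred_eq, Function.update_of_ne hyx] at hy
          exact (h hy).resolve_left hyx)
      refine ⟨(x, δ' x) :: l, ?_⟩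
      rw [redirectList, List.foldr_cons]
      change redirect x (δ' x) (redirectList l (ω, δ)) = _
      rw [hl]
      simp [redirect]
  exact main _ h δ' subset_rfl

/-- Almost sure properties persist under finite modifications of the directions. -/
theorem ae_forall_finite_modification {Q : SiteConfig d → DirConfig d → Prop}
    (h : ∀ᵐ c ∂oneChoiceMeasure d p, Q c.1 c.2) :
    ∀ᵐ c ∂oneChoiceMeasure d p, ∀ δ' : DirConfig d, {x | c.2 x ≠ δ' x}.Finite → Q c.1 δ' := by
  -- The uncountable quantifier over modified configurations becomes a countable one over lists of
  -- instructions.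
  have h1 : ∀ᵐ c ∂oneChoiceMeasure d p, ∀ l, Q (redirectList l c).1 (redirectList l c).2 :=
    ae_all_iff.2 fun l => (quasiMeasurePreserving_redirectList p l).ae h
  filter_upwards [h1] with c hc δ' hδ'
  obtain ⟨l, hl⟩ := exists_redirectList c.1 hδ'
  have := hc l
  rwa [hl] at this

end OneChoice

/-! ### Measurability of connectivity events. -/

section Measurability

variable {Ω V : Type*} [MeasurableSpace Ω] [Countable V]

theorem SimpleGraph.measurable_reachable {G : Ω → SimpleGraph V}
    (hG : ∀ u v, Measurable fun c => (G c).Adj u v) (u v : V) :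
    Measurable fun c => (G c).Reachable u v := by
  have h : ∀ c, (G c).Reachable u v ↔ ∃ n : ℕ, ∃ w : (G c).Walk u v, w.length = n := fun c =>
    ⟨fun ⟨w⟩ => ⟨_, w, rfl⟩, fun ⟨_, w, _⟩ => ⟨w⟩⟩
  simp only [h]
  refine Measurable.exists fun n => ?_
  clear h
  induction n generalizing u with
  | zero =>
    have : ∀ c, (∃ w : (G c).Walk u v, w.length = 0) ↔ u = v := fun c =>
      SimpleGraph.Walk.exists_length_eq_zero_iff
    simp only [this]
    exact measurable_const
  | succ n ih =>
    have : ∀ c, (∃ w : (G c).Walk u v, w.length = n + 1) ↔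
        ∃ u', (G c).Adj u u' ∧ ∃ w : (G c).Walk u' v, w.length = n := by
      intro c
      constructor
      · rintro ⟨w, hw⟩
        cases w with
        | nil => simp at hw
        | cons h w => exact ⟨_, h, w, by simpa using hw⟩
      · rintro ⟨u', h, w, hw⟩
        exact ⟨.cons h w, by simpa using hw⟩
    simp only [this]
    exact Measurable.exists fun u' => (hG u u').and (ih u')

theorem SimpleGraph.measurable_infinite_comp {G : Ω → SimpleGraph V}
    (hG : ∀ u v, Measurable fun c => (G c).Adj u v) (u : V) :
    Measurable fun c => ((G c).comp u).Infinite := by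
  have h : ∀ c, ((G c).comp u).Infinite ↔ ∀ F : Finset V, ∃ v, v ∉ F ∧ (G c).Reachable u v := by
    intro c
    constructor
    · intro h F
      obtain ⟨v, hv, hvF⟩ := h.exists_notMem_finset F
      exact ⟨v, hvF, hv⟩
    · intro h hfin
      obtain ⟨v, hv, hv'⟩ := h hfin.toFinset
      exact hv (hfin.mem_toFinset.2 hv')
  simp only [h]
  exact Measurable.forall fun F => Measurable.exists fun v =>
    measurable_const.and (measurable_reachable hG u v)

theorem SimpleGraph.measurable_trifurcation {G : Ω → SimpleGraph V}
    (hG : ∀ u v, Measurable fun c => (G c).Adj u v) (K : Set V) (y : Fin 3 → V) :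
    Measurable fun c => (G c).Trifurcation K y := by
  have hK : ∀ (L : Set V) u v, Measurable fun c => ((G c).within L).Adj u v := fun L u v =>
    (hG u v).and measurable_const
  have h : ∀ c, (G c).Trifurcation K y ↔ (∀ a b, a ∈ K → b ∈ K → ((G c).within K).Reachable a b) ∧
      (∀ a i, a ∈ K → (G c).Reachable a (y i)) ∧ (∀ i, (((G c).avoid K).comp (y i)).Infinite) ∧
      ∀ i j, i ≠ j → ¬((G c).avoid K).Reachable (y i) (y j) := fun c =>
    ⟨fun h => ⟨fun a b ha hb => h.1 a ha b hb, fun a i ha => h.2 a ha i, h.3, h.4⟩,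
      fun h => ⟨fun a ha b hb => h.1 a b ha hb, fun a ha i => h.2.1 a i ha, h.2.2.1, h.2.2.2⟩⟩
  simp only [h]
  refine Measurable.and ?_ (Measurable.and ?_ (Measurable.and ?_ ?_))
  · exact Measurable.forall fun a => Measurable.forall fun b =>
      measurable_const.imp (measurable_const.imp (measurable_reachable (hK K) a b))
  · exact Measurable.forall fun a => Measurable.forall fun i =>
      measurable_const.imp (measurable_reachable hG a (y i))
  · exact Measurable.forall fun i => measurable_infinite_comp (hK Kᶜ) (y i)
  · exact Measurable.forall fun i => Measurable.forall fun j =>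
      measurable_const.imp (measurable_reachable (hK Kᶜ) (y i) (y j)).not

end Measurability

/-! ### Measurability in the model, eventual periodicity and occupied sites. -/

namespace OneChoice

open Filter Topology

variable {d : ℕ}

theorem measurable_occupied (u : Site d) :
    Measurable fun c : SiteConfig d × DirConfig d => c.1 u = true :=
  measurableSet_setOfPred.1 (measurableSet_eq_fun (by fun_prop) measurable_const)

theorem measurable_feasible (u v : Site d) :
    Measurable fun c : SiteConfig d × DirConfig d => Feasible c.1 u v :=
  (measurable_occupied u).and <| (measurable_occupied v).and <| measurable_const.and <|
    Measurable.forall fun w => measurable_const.imp <| (measurable_occupied w).imp measurable_const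

theorem measurable_declares (u v : Site d) :
    Measurable fun c : SiteConfig d × DirConfig d => Declares c.1 c.2 u v := by
  refine (measurable_feasible u v).and ?_
  have h1 : Measurable fun c : SiteConfig d × DirConfig d => c.2 u := by fun_prop
  exact (measurable_of_finite fun a : Direction d => ∃ n : ℕ, v = u + n • a.vec).comp h1

theorem measurable_adj (x y : Site d) :
    Measurable fun c : SiteConfig d × DirConfig d => (blueGraph c.1 c.2).Adj x y :=
  measurable_const.and <| Measurable.exists fun u => Measurable.exists fun v =>
    ((measurable_declares u v).or (measurable_declares v u)).and measurable_const

theorem measurable_nxt (u v : Site d) :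
    Measurable fun c : SiteConfig d × DirConfig d => nxt c.1 c.2 u = v := by
  have h : ∀ c : SiteConfig d × DirConfig d, nxt c.1 c.2 u = v ↔
      Declares c.1 c.2 u v ∨ (u = v ∧ ¬∃ w, Declares c.1 c.2 u w) := by
    intro c
    by_cases hex : ∃ w, Declares c.1 c.2 u w
    · obtain ⟨w, hw⟩ := hex
      rw [hw.nxt_eq]
      constructor
      · rintro rfl
        exact Or.inl hw
      · rintro (h | h)
        · exact Next.unique hw h
        · exact absurd ⟨w, hw⟩ h.2
    · rw [nxt, dif_neg hex]
      constructor
      · exact fun h => Or.inr ⟨h, hex⟩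
      · rintro (h | h)
        · exact absurd ⟨v, h⟩ hex
        · exact h.1
  simp only [h]
  exact (measurable_declares u v).or (measurable_const.and
    (Measurable.exists fun w => measurable_declares u w).not)

theorem measurable_iterate_nxt (n : ℕ) (u v : Site d) :
    Measurable fun c : SiteConfig d × DirConfig d => (nxt c.1 c.2)^[n] u = v := by
  induction n generalizing v with
  | zero => exact measurable_const (a := u = v)
  | succ n ih =>
    have h : ∀ c : SiteConfig d × DirConfig d, (nxt c.1 c.2)^[n + 1] u = v ↔
        ∃ w, (nxt c.1 c.2)^[n] u = w ∧ nxt c.1 c.2 w = v := fun c => by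
      simp [Function.iterate_succ_apply']
    simp only [h]
    exact Measurable.exists fun w => (ih w).and (measurable_nxt w v)

/-- The first `n + 1` sites of the orbit of `x` are distinct. -/
def distinctOrbit (x : Site d) (n : ℕ) : Set (SiteConfig d × DirConfig d) :=
  {c | ∀ i ≤ n, ∀ j ≤ n, (nxt c.1 c.2)^[i] x = (nxt c.1 c.2)^[j] x → i = j}

theorem measurableSet_distinctOrbit (x : Site d) (n : ℕ) :
    MeasurableSet (distinctOrbit x n) := by
  refine measurableSet_setOfPred.2 ?_
  refine Measurable.forall fun i => measurable_const.imp <| Measurable.forall fun j =>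
    measurable_const.imp <| Measurable.imp ?_ measurable_const
  have h : ∀ c : SiteConfig d × DirConfig d,
      (nxt c.1 c.2)^[i] x = (nxt c.1 c.2)^[j] x ↔
        ∃ w, (nxt c.1 c.2)^[i] x = w ∧ (nxt c.1 c.2)^[j] x = w := fun c => by simp [eq_comm]
  simp only [h]
  exact Measurable.exists fun w =>
    (measurable_iterate_nxt i x w).and (measurable_iterate_nxt j x w)

theorem distinctOrbit_antitone (x : Site d) : Antitone (distinctOrbit x) :=
  fun _ _ hmn _ hc i hi j hj => hc i (hi.trans hmn) j (hj.trans hmn)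

theorem nxt_congr {ω : SiteConfig d} {δ δ' : DirConfig d} {u : Site d} (h : δ u = δ' u) :
    nxt ω δ u = nxt ω δ' u := by
  have : ∀ v, Declares ω δ u v ↔ Declares ω δ' u v := fun v => by
    rw [declares_iff, declares_iff, h]
  by_cases hex : ∃ v, Declares ω δ u v
  · obtain ⟨v, hv⟩ := hex
    rw [hv.nxt_eq, ((this v).1 hv).nxt_eq]
  · rw [nxt, nxt, dif_neg hex, dif_neg (by simpa only [← this] using hex)]

variable [NeZero d] (p : unitInterval)

/-- When the orbit reaches the fresh site `y` from `z`, the direction at `y` has not been consulted.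
It points back to `z` with conditional probability 1/(2d), and then step `n + 2` repeats `z`. The
inequality is this geometric decay written without subtraction. -/
theorem measure_distinctOrbit_inter_le (x z y : Site d) (n : ℕ) :
    Fintype.card (Direction d) * oneChoiceMeasure d p (distinctOrbit x (n + 2) ∩
        {c | (nxt c.1 c.2)^[n] x = z ∧ (nxt c.1 c.2)^[n + 1] x = y}) +
      oneChoiceMeasure d p (distinctOrbit x (n + 1) ∩
        {c | (nxt c.1 c.2)^[n] x = z ∧ (nxt c.1 c.2)^[n + 1] x = y}) ≤
    Fintype.card (Direction d) * oneChoiceMeasure d p (distinctOrbit x (n + 1) ∩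
        {c | (nxt c.1 c.2)^[n] x = z ∧ (nxt c.1 c.2)^[n + 1] x = y}) := by
  classical
  set A : Set (SiteConfig d × DirConfig d) :=
    {c | (nxt c.1 c.2)^[n] x = z ∧ (nxt c.1 c.2)^[n + 1] x = y} with hA
  set S := distinctOrbit x (n + 1) ∩ A with hS
  have hAm : MeasurableSet A := measurableSet_setOfPred.2
    ((measurable_iterate_nxt n x z).and (measurable_iterate_nxt (n + 1) x y))
  have hSm : MeasurableSet S := (measurableSet_distinctOrbit x (n + 1)).inter hAm
  have hsub : distinctOrbit x (n + 2) ∩ A ⊆ S :=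
    Set.inter_subset_inter_left _ (distinctOrbit_antitone x (Nat.le_succ _))
  rcases S.eq_empty_or_nonempty with h0 | ⟨c₀, hc₀, hz₀, hy₀⟩
  · rw [Set.subset_eq_empty hsub h0, h0]
    simp
  have hzy : z ≠ y := by
    rintro rfl
    have := hc₀ n (by omega) (n + 1) le_rfl (hz₀.trans hy₀.symm)
    omega
  have hD₀ : Declares c₀.1 c₀.2 z y := by
    rw [Function.iterate_succ_apply', hz₀] at hy₀
    have := declares_nxt_of_ne (ω := c₀.1) (δ := c₀.2) (u := z) (by rw [hy₀]; exact hzy.symm)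
    rwa [hy₀] at this
  -- The direction from `y` to `z` depends on the two sites only, so one sample configuration
  -- determines it for all.
  obtain ⟨b, -, hb⟩ := hD₀.1.symm.exists_next
  have hinv : ∀ c ∈ S, ∀ a, redirect y a c ∈ S := by
    rintro c ⟨hc, hcz, hcy⟩ a
    have hit : ∀ i ≤ n + 1, (nxt (redirect y a c).1 (redirect y a c).2)^[i] x =
        (nxt c.1 c.2)^[i] x := by
      intro i
      induction i with
      | zero => exact fun _ => rfl
      | succ i ih =>
        intro hi
        rw [Function.iterate_succ_apply', Function.iterate_succ_apply', ih (by omega)]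
        refine nxt_congr (Function.update_of_ne ?_ _ _)
        intro he
        have := hc i (by omega) (n + 1) le_rfl (he.trans hcy.symm)
        omega
    refine ⟨fun i hi j hj he => hc i hi j hj ?_, (hit n (by omega)).trans hcz,
      (hit (n + 1) le_rfl).trans hcy⟩
    rwa [hit i hi, hit j hj] at he
  have hmain := measure_inter_dir p y b hSm hinv
  have hdisj : Disjoint (distinctOrbit x (n + 2) ∩ A) (S ∩ {c | c.2 y = b}) := by
    rw [Set.disjoint_left]
    rintro c ⟨hc, hcz, hcy⟩ ⟨-, hcb⟩
    have hD : Declares c.1 c.2 z y := by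
      rw [Function.iterate_succ_apply', hcz] at hcy
      have := declares_nxt_of_ne (ω := c.1) (δ := c.2) (u := z) (by rw [hcy]; exact hzy.symm)
      rwa [hcy] at this
    have hD' : Declares c.1 c.2 y z := ⟨hD.1.symm, by
      obtain ⟨m, hm⟩ := hb
      exact ⟨m, by rw [hcb]; exact hm⟩⟩
    have h2 : (nxt c.1 c.2)^[n + 2] x = z := by
      rw [Function.iterate_succ_apply', hcy, hD'.nxt_eq]
    have := hc n (by omega) (n + 2) le_rfl (hcz.trans h2.symm)
    omega
  calc _ = Fintype.card (Direction d) * (oneChoiceMeasure d p (distinctOrbit x (n + 2) ∩ A) +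
        oneChoiceMeasure d p (S ∩ {c | c.2 y = b})) := by rw [mul_add, hmain]
    _ = Fintype.card (Direction d) * oneChoiceMeasure d p
        ((distinctOrbit x (n + 2) ∩ A) ∪ (S ∩ {c | c.2 y = b})) := by
      rw [measure_union hdisj (hSm.inter (measurableSet_dir y b))]
    _ ≤ _ := by
      gcongr
      exact Set.union_subset hsub Set.inter_subset_left

theorem measure_distinctOrbit_le (x : Site d) (n : ℕ) :
    Fintype.card (Direction d) * oneChoiceMeasure d p (distinctOrbit x (n + 2)) +
      oneChoiceMeasure d p (distinctOrbit x (n + 1)) ≤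
    Fintype.card (Direction d) * oneChoiceMeasure d p (distinctOrbit x (n + 1)) := by
  have key : ∀ m, oneChoiceMeasure d p (distinctOrbit x m) = ∑' q : Site d × Site d,
      oneChoiceMeasure d p (distinctOrbit x m ∩
        {c | (nxt c.1 c.2)^[n] x = q.1 ∧ (nxt c.1 c.2)^[n + 1] x = q.2}) := by
    intro m
    rw [← measure_iUnion]
    · congr 1
      ext c
      simp
    · intro q q' hq
      refine Set.disjoint_left.2 fun c hc hc' => hq (Prod.ext ?_ ?_)
      · exact hc.2.1.symm.trans hc'.2.1
      · exact hc.2.2.symm.trans hc'.2.2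
    · exact fun q => (measurableSet_distinctOrbit x m).inter (measurableSet_setOfPred.2
        ((measurable_iterate_nxt n x q.1).and (measurable_iterate_nxt (n + 1) x q.2)))
  rw [key (n + 2), key (n + 1), ← ENNReal.tsum_mul_left, ← ENNReal.tsum_mul_left,
    ← ENNReal.tsum_add]
  exact ENNReal.tsum_le_tsum fun q => measure_distinctOrbit_inter_le p x q.1 q.2 n

/-- Almost surely, all orbits are eventually periodic. -/
theorem ae_eventuallyPeriodic :
    ∀ᵐ c ∂oneChoiceMeasure d p, EventuallyPeriodic c.1 c.2 := by
  refine ae_all_iff.2 fun x => ?_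
  have h1 : Tendsto (fun n => oneChoiceMeasure d p (distinctOrbit x n)) atTop
      (𝓝 (oneChoiceMeasure d p (⋂ n, distinctOrbit x n))) :=
    tendsto_measure_iInter_atTop (fun n => (measurableSet_distinctOrbit x n).nullMeasurableSet)
      (distinctOrbit_antitone x) ⟨0, measure_ne_top _ _⟩
  have h2 : oneChoiceMeasure d p (⋂ n, distinctOrbit x n) = 0 := by
    -- In the limit L the decay reads 2d·L + L ≤ 2d·L with finite terms, which forces L = 0.
    have h3 := le_of_tendsto_of_tendsto'
      ((ENNReal.Tendsto.const_mul ((tendsto_add_atTop_iff_nat 2).2 h1)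
        (Or.inr (ENNReal.natCast_ne_top _))).add ((tendsto_add_atTop_iff_nat 1).2 h1))
      (ENNReal.Tendsto.const_mul ((tendsto_add_atTop_iff_nat 1).2 h1)
        (Or.inr (ENNReal.natCast_ne_top _))) (measure_distinctOrbit_le p x)
    refine le_antisymm (ENNReal.le_of_add_le_add_left (ENNReal.mul_ne_top
      (ENNReal.natCast_ne_top (Fintype.card (Direction d)))
      (measure_ne_top (oneChoiceMeasure d p) (⋂ n, distinctOrbit x n)))
      (by rw [add_zero]; exact h3)) bot_le
  filter_upwards [measure_eq_zero_iff_ae_notMem.1 h2] with c hc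
  simp only [Set.mem_iInter, distinctOrbit, Set.mem_ofPred_eq, not_forall] at hc
  obtain ⟨n, i, -, j, -, he, hij⟩ := hc
  rcases lt_or_gt_of_ne hij with h | h
  · exact ⟨j, i, h, he⟩
  · exact ⟨i, j, h, he.symm⟩

theorem measure_occupied_ne_zero (hp : 0 < p) (F : Finset (Site d)) :
    oneChoiceMeasure d p {c | ∀ x ∈ F, c.1 x = true} ≠ 0 := by
  have h1 : {c : SiteConfig d × DirConfig d | ∀ x ∈ F, c.1 x = true} =
      Prod.fst ⁻¹' ((F : Set (Site d)).pi fun _ => {true}) := by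
    ext c
    simp
  have h2 : MeasurableSet ((F : Set (Site d)).pi fun _ => ({true} : Set Bool)) :=
    .pi F.countable_toSet fun _ _ => measurableSet_singleton _
  rw [h1, oneChoiceMeasure, measurePreserving_fst.measure_preimage h2.nullMeasurableSet,
    siteMeasure, Measure.infinitePi_pi _ fun _ _ => measurableSet_singleton _]
  refine Finset.prod_ne_zero_iff.2 fun x _ => ?_
  have hp' : (unitInterval.toNNReal p) ≠ 0 := fun h => hp.ne' (by
    apply Subtype.ext
    have := congrArg NNReal.toReal h
    simpa using this)
  rw [bernoulliMeasure_def]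
  simp [hp']

/-- Recurrence applied to the translation by `a.vec`. A single site gives `Unbounded`; a pair of
sites gives `Crossing`. -/
theorem ae_frequently_occupied (hp : 0 < p) (F : Finset (Site d)) (a : Direction d) :
    ∀ᵐ c ∂oneChoiceMeasure d p, ∃ᶠ n : ℕ in atTop, ∀ x ∈ F, c.1 (x + n • a.vec) = true := by
  have hm : MeasurableSet {c : SiteConfig d × DirConfig d | ∀ x ∈ F, c.1 x = true} :=
    measurableSet_setOfPred.2 (Measurable.forall fun x => measurable_const.imp (measurable_occupied x))
  filter_upwards [(ergodic_shiftConfig p a.vec_ne_zero).ae_frequently_mem hm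
    (measure_occupied_ne_zero p hp F)] with c hc
  refine hc.mono fun n hn x hx => ?_
  rw [shiftConfig, Prod.map_iterate, shift_iterate, shift_iterate] at hn
  exact hn x hx

theorem ae_unbounded (hp : 0 < p) : ∀ᵐ c ∂oneChoiceMeasure d p, Unbounded c.1 := by
  refine ae_all_iff.2 fun u => ae_all_iff.2 fun a => ?_
  filter_upwards [ae_frequently_occupied p hp {u} a] with c hc
  obtain ⟨n, hn, h⟩ := frequently_atTop.1 hc 1
  exact ⟨n, hn, h u (by simp)⟩

theorem ae_crossing (hp : 0 < p) : ∀ᵐ c ∂oneChoiceMeasure d p, Crossing c.1 := by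
  classical
  refine ae_all_iff.2 fun x => ae_all_iff.2 fun j => ae_all_iff.2 fun e => ?_
  filter_upwards [ae_frequently_occupied p hp {x, x + Pi.single j e} (0, true)] with c hc
  obtain ⟨n, h⟩ := hc.exists
  refine ⟨n, h x (by simp), ?_⟩
  rw [add_right_comm]
  exact h _ (by simp)

end OneChoice

/-! ### Translation equivariance of the cluster events. -/

namespace SimpleGraph

variable {V : Type*} {G G' : SimpleGraph V} (σ : V ≃ V)

theorem reachable_iff_of_equiv (h : ∀ x y, G'.Adj x y ↔ G.Adj (σ x) (σ y)) (x y : V) :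
    G'.Reachable x y ↔ G.Reachable (σ x) (σ y) :=
  (Iso.reachable_iff (φ := (⟨σ, fun {a b} => (h a b).symm⟩ : G' ≃g G))).symm

theorem infinite_comp_iff_of_equiv (h : ∀ x y, G'.Adj x y ↔ G.Adj (σ x) (σ y)) (x : V) :
    (G'.comp x).Infinite ↔ (G.comp (σ x)).Infinite := by
  have : σ ⁻¹' G.comp (σ x) = G'.comp x := by
    ext v
    exact (reachable_iff_of_equiv σ h x v).symm
  rw [← this, ← σ.image_symm_eq_preimage, Set.infinite_image_iff σ.symm.injective.injOn]

theorem Trifurcation.of_equiv (h : ∀ x y, G'.Adj x y ↔ G.Adj (σ x) (σ y)) {K : Set V}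
    {y : Fin 3 → V} (hT : G'.Trifurcation K y) : G.Trifurcation (σ '' K) (σ ∘ y) := by
  have hw : ∀ (L : Set V) x y, (G'.within L).Adj x y ↔ (G.within (σ '' L)).Adj (σ x) (σ y) :=
    fun L x y => by simp [within, h]
  have hc : (σ '' K)ᶜ = σ '' Kᶜ := (Set.image_compl_eq σ.bijective).symm
  refine ⟨?_, ?_, fun i => ?_, fun i j hij => ?_⟩
  · rintro _ ⟨a, ha, rfl⟩ _ ⟨b, hb, rfl⟩
    exact (reachable_iff_of_equiv σ (hw K) a b).1 (hT.conn a ha b hb)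
  · rintro _ ⟨a, ha, rfl⟩ i
    exact (reachable_iff_of_equiv σ h a (y i)).1 (hT.reach a ha i)
  · rw [avoid, hc]
    exact (infinite_comp_iff_of_equiv σ (hw Kᶜ) (y i)).1 (hT.infinite i)
  · rw [avoid, hc]
    exact fun hr => hT.separated i j hij ((reachable_iff_of_equiv σ (hw Kᶜ) _ _).2 hr)

end SimpleGraph

namespace OneChoice

open Filter Topology

variable {d : ℕ}

theorem add_mem_uIcc_iff (u v w z : Site d) :
    w + z ∈ Set.uIcc (u + z) (v + z) ↔ w ∈ Set.uIcc u v := by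
  simp [mem_uIcc_iff]

theorem feasible_shift_iff (ω : SiteConfig d) (z u v : Site d) :
    Feasible (shift z ω) u v ↔ Feasible ω (u + z) (v + z) := by
  have h : (∀ w ∈ Set.uIcc u v, shift z ω w = true → w = u ∨ w = v) ↔
      ∀ w ∈ Set.uIcc (u + z) (v + z), ω w = true → w = u + z ∨ w = v + z := by
    constructor
    · intro h w hw hw'
      have := h (w - z) (by rwa [← add_mem_uIcc_iff _ _ _ z, sub_add_cancel])
        (by rwa [shift, sub_add_cancel])
      rwa [sub_eq_iff_eq_add, sub_eq_iff_eq_add] at this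
    · intro h w hw hw'
      simpa using h (w + z) ((add_mem_uIcc_iff _ _ _ z).2 hw) hw'
  unfold Feasible
  rw [h]
  simp [shift]

theorem declares_shift_iff (ω : SiteConfig d) (δ : DirConfig d) (z u v : Site d) :
    Declares (shift z ω) (shift z δ) u v ↔ Declares ω δ (u + z) (v + z) := by
  unfold Declares
  rw [feasible_shift_iff]
  refine and_congr Iff.rfl (exists_congr fun n => ?_)
  rw [add_right_comm, add_left_inj, shift]

theorem adj_shift_iff (ω : SiteConfig d) (δ : DirConfig d) (z x y : Site d) :
    (blueGraph (shift z ω) (shift z δ)).Adj x y ↔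
      (blueGraph ω δ).Adj (Equiv.addRight z x) (Equiv.addRight z y) := by
  simp only [Equiv.coe_addRight, blueGraph, BlueSegment, declares_shift_iff, Pi.add_apply,
    add_sub_add_right_eq_sub]
  refine and_congr Iff.rfl ?_
  constructor
  · rintro ⟨u, v, h, hx, hy⟩
    exact ⟨u + z, v + z, h, (add_mem_uIcc_iff _ _ _ z).2 hx, (add_mem_uIcc_iff _ _ _ z).2 hy⟩
  · rintro ⟨u, v, h, hx, hy⟩
    refine ⟨u - z, v - z, by simpa using h, ?_, ?_⟩
    · rwa [← add_mem_uIcc_iff _ _ _ z, sub_add_cancel, sub_add_cancel]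
    · rwa [← add_mem_uIcc_iff _ _ _ z, sub_add_cancel, sub_add_cancel]

/-- There is an infinite cluster. -/
def OneInfinite (ω : SiteConfig d) (δ : DirConfig d) : Prop :=
  ∃ x, ((blueGraph ω δ).comp x).Infinite

theorem oneInfinite_shift_iff (ω : SiteConfig d) (δ : DirConfig d) (z : Site d) :
    OneInfinite (shift z ω) (shift z δ) ↔ OneInfinite ω δ :=
  (Equiv.addRight z).exists_congr fun x =>
    SimpleGraph.infinite_comp_iff_of_equiv _ (adj_shift_iff ω δ z) x

theorem twoInfinite_shift_iff (ω : SiteConfig d) (δ : DirConfig d) (z : Site d) :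
    TwoInfinite (shift z ω) (shift z δ) ↔ TwoInfinite ω δ :=
  (Equiv.addRight z).exists_congr fun x => (Equiv.addRight z).exists_congr fun y =>
    and_congr (SimpleGraph.infinite_comp_iff_of_equiv _ (adj_shift_iff ω δ z) x) <|
      and_congr (SimpleGraph.infinite_comp_iff_of_equiv _ (adj_shift_iff ω δ z) y) <|
        not_congr (SimpleGraph.reachable_iff_of_equiv _ (adj_shift_iff ω δ z) x y)

/-! ### Trifurcations have probability zero. -/

/-- A finite set of sites lies in a box. -/
theorem exists_box (F : Finset (Site d)) : ∃ R : ℕ, ∀ x ∈ F, ∀ i, |x i| ≤ R := by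
  induction F using Finset.induction_on with
  | empty => exact ⟨0, by simp⟩
  | insert a F _ ih =>
    obtain ⟨R, hR⟩ := ih
    refine ⟨R + ∑ i, (a i).natAbs, fun x hx i => ?_⟩
    have h0 : |a i| ≤ ∑ i, |a i| :=
      Finset.single_le_sum (f := fun i => |a i|) (fun _ _ => abs_nonneg _) (Finset.mem_univ i)
    have h1 := abs_nonneg (a i)
    push_cast
    rcases Finset.mem_insert.1 hx with rfl | hx
    · linarith [Int.natCast_nonneg R]
    · linarith [hR x hx i]

/-- The number of trifurcations among `n ^ d` translates is at most of the order of
`n ^ (d - 1)`. -/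
theorem card_trifurcation_translates_le {ω : SiteConfig d} {δ : DirConfig d}
    {K : Finset (Site d)} (hK : K.Nonempty) {y : Fin 3 → Site d} {R : ℕ}
    (hKR : ∀ x ∈ K, ∀ i, |x i| ≤ R) (hyR : ∀ j i, |y j i| ≤ R) (n : ℕ)
    (T : Finset (Fin d → ℕ)) (hTn : ∀ v ∈ T, ∀ i, v i < n)
    (hT : ∀ v ∈ T, (blueGraph ω δ).Trifurcation
      (Equiv.addRight (fun i => (2 * R + 1 : ℤ) * v i) '' (K : Set (Site d)))
      (Equiv.addRight (fun i => (2 * R + 1 : ℤ) * v i) ∘ y)) :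
    T.card ≤ ((2 * R + 1) * n + (2 * R + 3)) ^ d - ((2 * R + 1) * n + (2 * R + 1)) ^ d := by
  classical
  set N : ℤ := (2 * R + 1) * n with hN
  set L : Finset (Site d) := Finset.Icc (fun _ => -(R : ℤ)) (fun _ => N + R) with hL
  -- Blue edges join nearest neighbours, so a path leaving `L` must pass through the shell `L' \ L`
  -- of thickness one.
  set L' : Finset (Site d) := Finset.Icc (fun _ => -(R : ℤ) - 1) (fun _ => N + R + 1) with hL'
  have hLL' : L ⊆ L' := Finset.Icc_subset_Icc (fun _ => by simp) (fun _ => by simp)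
  have hbound : ∀ v ∈ T, ∀ x : Site d, (∀ i, |x i| ≤ R) →
      (Equiv.addRight (fun i => (2 * R + 1 : ℤ) * v i) x : Site d) ∈ L := by
    intro v hv x hx
    rw [hL, Finset.mem_Icc]
    constructor <;> intro i
    · have h1 := abs_le.1 (hx i)
      have h2 : (0 : ℤ) ≤ (2 * R + 1) * v i := by positivity
      simp only [Equiv.coe_addRight, Pi.add_apply]
      omega
    · have h1 := abs_le.1 (hx i)
      have h2 : (2 * R + 1 : ℤ) * v i ≤ N := by
        rw [hN]
        have : (v i : ℤ) ≤ n := by exact_mod_cast (hTn v hv i).le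
        gcongr
      simp only [Equiv.coe_addRight, Pi.add_apply]
      omega
  have hcard : (L' \ L).card =
      ((2 * R + 1) * n + (2 * R + 3)) ^ d - ((2 * R + 1) * n + (2 * R + 1)) ^ d := by
    rw [Finset.card_sdiff_of_subset hLL', hL, hL', Pi.card_Icc, Pi.card_Icc]
    simp only [Int.card_Icc, Finset.prod_const, Finset.card_univ, Fintype.card_fin]
    have hN' : N = ((2 * R + 1) * n : ℕ) := by rw [hN]; push_cast; rfl
    congr 2 <;> omega
  rw [← hcard]
  refine SimpleGraph.card_trifurcations_le T _ _ (L := (L : Set (Site d))) L.finite_toSet _ ?_ hT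
    (fun v _ => (Finset.coe_nonempty.2 hK).image _) ?_ (fun v hv j => hbound v hv _ (hyR j)) ?_
  · intro u hu v hv huv
    rw [Finset.mem_sdiff]
    refine ⟨?_, hv⟩
    rw [Finset.mem_coe, hL, Finset.mem_Icc] at hu
    rw [hL', Finset.mem_Icc]
    have h1 := fun i => abs_le.1 (abs_sub_le_one_of_adj huv i)
    constructor <;> intro i
    · have h2 := hu.1 i
      have h3 := h1 i
      simp only at h2 ⊢
      omega
    · have h2 := hu.2 i
      have h3 := h1 i
      simp only at h2 ⊢
      omega
  · rintro v hv _ ⟨x, hx, rfl⟩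
    exact hbound v hv x (hKR x hx)
  · intro v _ v' _ hvv
    rw [Set.disjoint_left]
    rintro _ ⟨x, hx, rfl⟩ ⟨x', hx', he⟩
    refine hvv (funext fun i => ?_)
    have h1 := abs_le.1 (hKR x hx i)
    have h2 := abs_le.1 (hKR x' hx' i)
    have h3 := congrFun he i
    simp only [Equiv.coe_addRight, Pi.add_apply] at h3
    -- The spacing `2 * R + 1` exceeds the width of the box holding `K`, so distinct translates are
    -- disjoint.
    have h4 : (2 * R + 1 : ℤ) * (v i - v' i) = x' i - x i := by linarith
    by_contra hne
    rcases lt_or_gt_of_ne hne with h | h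
    · have h5 : (v i : ℤ) - v' i ≤ -1 := by omega
      nlinarith
    · have h5 : 1 ≤ (v i : ℤ) - v' i := by omega
      nlinarith

/-- After division by `n ^ d` both powers tend to the same limit `(2 * R + 1) ^ d`. -/
theorem tendsto_boundary_div_volume (R d : ℕ) :
    Tendsto (fun n : ℕ => (((((2 * R + 1) * n + (2 * R + 3)) ^ d -
      ((2 * R + 1) * n + (2 * R + 1)) ^ d : ℕ) : ℝ) / (n : ℝ) ^ d)) atTop (𝓝 0) := by
  have h1 : ∀ b : ℝ, Tendsto (fun n : ℕ => (((2 * R + 1) * n + b) / n) ^ d) atTop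
      (𝓝 ((2 * R + 1 : ℝ) ^ d)) := by
    intro b
    have h2 : Tendsto (fun n : ℕ => (2 * R + 1 : ℝ) + b / n) atTop (𝓝 (2 * R + 1 + 0)) :=
      tendsto_const_nhds.add (tendsto_const_div_atTop_nhds_zero_nat b)
    rw [add_zero] at h2
    refine (h2.pow d).congr' ?_
    filter_upwards [eventually_gt_atTop 0] with n hn
    have : (n : ℝ) ≠ 0 := by positivity
    congr 1
    field_simp
  have h3 := (h1 (2 * R + 3)).sub (h1 (2 * R + 1))
  rw [sub_self] at h3
  refine h3.congr fun n => ?_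
  rw [Nat.cast_sub (Nat.pow_le_pow_left (by omega) d), div_pow, div_pow, ← sub_div]
  push_cast
  rfl

variable [NeZero d] (p : unitInterval)

/-- Trifurcations have probability zero. -/
theorem measure_trifurcation_eq_zero {K : Finset (Site d)} (hK : K.Nonempty)
    (y : Fin 3 → Site d) :
    oneChoiceMeasure d p {c | (blueGraph c.1 c.2).Trifurcation (K : Set (Site d)) y} = 0 := by
  classical
  obtain ⟨R, hR⟩ := exists_box (K ∪ Finset.univ.image y)
  set E : (Fin d → ℕ) → Set (SiteConfig d × DirConfig d) := fun v =>
    {c | (blueGraph c.1 c.2).Trifurcation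
      (Equiv.addRight (fun i => (2 * R + 1 : ℤ) * v i) '' (K : Set (Site d)))
      (Equiv.addRight (fun i => (2 * R + 1 : ℤ) * v i) ∘ y)} with hE
  set E₀ := {c : SiteConfig d × DirConfig d |
    (blueGraph c.1 c.2).Trifurcation (K : Set (Site d)) y} with hE₀
  have hEm : ∀ v, MeasurableSet (E v) := fun v => measurableSet_setOfPred.2
    (SimpleGraph.measurable_trifurcation measurable_adj _ _)
  have hE₀m : MeasurableSet E₀ := measurableSet_setOfPred.2
    (SimpleGraph.measurable_trifurcation measurable_adj _ _)
  have hle : ∀ v, oneChoiceMeasure d p E₀ ≤ oneChoiceMeasure d p (E v) := by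
    intro v
    rw [← (measurePreserving_shiftConfig p (fun i => (2 * R + 1 : ℤ) * v i)).measure_preimage
      hE₀m.nullMeasurableSet]
    refine measure_mono fun c hc => ?_
    exact SimpleGraph.Trifurcation.of_equiv _ (adj_shift_iff c.1 c.2 _) hc
  -- First moment: by translation invariance the expected number of trifurcations among the `n ^ d`
  -- translates is at least the left-hand side, while the deterministic count bounds that number for
  -- every configuration.
  have hmain : ∀ n : ℕ, (n : ℝ) ^ d * (oneChoiceMeasure d p).real E₀ ≤
      ((((2 * R + 1) * n + (2 * R + 3)) ^ d - ((2 * R + 1) * n + (2 * R + 1)) ^ d : ℕ) : ℝ) := by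
    intro n
    set B := ((2 * R + 1) * n + (2 * R + 3)) ^ d - ((2 * R + 1) * n + (2 * R + 1)) ^ d
    set I : Finset (Fin d → ℕ) := Fintype.piFinset fun _ => Finset.range n
    have h1 : (n : ENNReal) ^ d * oneChoiceMeasure d p E₀ ≤ B := by
      calc (n : ENNReal) ^ d * oneChoiceMeasure d p E₀
          = ∑ _v ∈ I, oneChoiceMeasure d p E₀ := by
            simp [I, Fintype.card_piFinset]
        _ ≤ ∑ v ∈ I, oneChoiceMeasure d p (E v) := Finset.sum_le_sum fun v _ => hle v
        _ = ∑ v ∈ I, ∫⁻ c, (E v).indicator 1 c ∂oneChoiceMeasure d p := by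
            simp [lintegral_indicator_one (hEm _)]
        _ = ∫⁻ c, ∑ v ∈ I, (E v).indicator 1 c ∂oneChoiceMeasure d p :=
            (lintegral_finsetSum _ fun v _ => measurable_one.indicator (hEm v)).symm
        _ ≤ ∫⁻ _, (B : ENNReal) ∂oneChoiceMeasure d p := by
            refine lintegral_mono fun c => ?_
            have h2 : ∑ v ∈ I, (E v).indicator (1 : SiteConfig d × DirConfig d → ENNReal) c =
                ((I.filter fun v => c ∈ E v).card : ENNReal) := by
              simp [Set.indicator_apply]
            rw [h2]
            refine Nat.cast_le.2 (card_trifurcation_translates_le (ω := c.1) (δ := c.2) hK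
              (fun x hx => hR x (Finset.mem_union_left _ hx))
              (fun j => hR (y j) (Finset.mem_union_right _
                (Finset.mem_image_of_mem _ (Finset.mem_univ j)))) n _ ?_ ?_)
            · intro v hv i
              have := (Finset.mem_filter.1 hv).1
              simpa using Fintype.mem_piFinset.1 this i
            · exact fun v hv => (Finset.mem_filter.1 hv).2
        _ = B := by simp
    have h2 := ENNReal.toReal_mono (ENNReal.natCast_ne_top B) h1
    simpa [ENNReal.toReal_mul, measureReal_def] using h2
  have h0 : (oneChoiceMeasure d p).real E₀ ≤ 0 := by
    refine ge_of_tendsto (tendsto_boundary_div_volume R d) ?_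
    filter_upwards [eventually_gt_atTop 0] with n hn
    rw [le_div_iff₀ (by positivity), mul_comm]
    exact hmain n
  exact (measureReal_eq_zero_iff (measure_ne_top _ _)).1 (le_antisymm h0 measureReal_nonneg)

/-! ### Uniqueness and the number of infinite clusters. -/

omit [NeZero d] in
theorem measurable_oneInfinite :
    Measurable fun c : SiteConfig d × DirConfig d => OneInfinite c.1 c.2 :=
  Measurable.exists fun x => SimpleGraph.measurable_infinite_comp measurable_adj x

omit [NeZero d] in
theorem measurable_twoInfinite :
    Measurable fun c : SiteConfig d × DirConfig d => TwoInfinite c.1 c.2 :=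
  Measurable.exists fun x => Measurable.exists fun y =>
    (SimpleGraph.measurable_infinite_comp measurable_adj x).and <|
      (SimpleGraph.measurable_infinite_comp measurable_adj y).and
        (SimpleGraph.measurable_reachable measurable_adj x y).not

/-- Almost surely, there is at most one infinite cluster. -/
theorem ae_not_twoInfinite (hp : 0 < p) :
    ∀ᵐ c ∂oneChoiceMeasure d p, ¬TwoInfinite c.1 c.2 := by
  have herg := (ergodic_shiftConfig (d := d) p (Direction.vec_ne_zero (0, true))).toPreErgodic
  rcases herg.ae_mem_or_ae_notMem (measurableSet_setOfPred.2 measurable_twoInfinite)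
    (Set.ext fun c => twoInfinite_shift_iff c.1 c.2 _) with h | h
  · exfalso
    have h1 := ae_forall_finite_modification p (Q := TwoInfinite) h
    have h2 := ae_forall_finite_modification p (ae_eventuallyPeriodic (d := d) p)
    have h3 : ∀ᵐ c ∂oneChoiceMeasure d p, ∀ (K : Finset (Site d)) (y : Fin 3 → Site d),
        K.Nonempty → ¬(blueGraph c.1 c.2).Trifurcation (K : Set (Site d)) y := by
      refine ae_all_iff.2 fun K => ae_all_iff.2 fun y => ?_
      by_cases hK : K.Nonempty
      · filter_upwards [measure_eq_zero_iff_ae_notMem.1 (measure_trifurcation_eq_zero p hK y)]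
          with c hc _
        exact hc
      · exact ae_of_all _ fun c h => absurd h hK
    have h4 := ae_forall_finite_modification p (Q := fun ω δ => ∀ (K : Finset (Site d))
      (y : Fin 3 → Site d), K.Nonempty → ¬(blueGraph ω δ).Trifurcation (K : Set (Site d)) y) h3
    obtain ⟨c, hc1, hc2, hc4, hc5, hc6⟩ :=
      (h1.and (h2.and (h4.and ((ae_unbounded p hp).and (ae_crossing p hp))))).exists
    obtain ⟨δ', hδ', K, y, hK, hT⟩ := exists_trifurcation hc5
      (fun u v hu hv => hc6.reflTransGen_feasible hc5 hu hv) hc2 hc1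
    exact hc4 δ' hδ' K y hK hT
  · exact h

omit [NeZero d] in
theorem numInfiniteClusters_eq_zero {ω : SiteConfig d} {δ : DirConfig d}
    (h : ¬OneInfinite ω δ) : numInfiniteClusters ω δ = 0 := by
  rw [numInfiniteClusters, Set.encard_eq_zero, Set.eq_empty_iff_forall_notMem]
  intro C
  induction C using SimpleGraph.ConnectedComponent.ind with
  | h v =>
    intro hC
    refine h ⟨v, ?_⟩
    have heq : ((blueGraph ω δ).connectedComponentMk v).supp = (blueGraph ω δ).comp v := by
      ext w
      exact SimpleGraph.ConnectedComponent.eq.trans SimpleGraph.reachable_comm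
    rw [← heq]
    exact hC

omit [NeZero d] in
theorem numInfiniteClusters_eq_one {ω : SiteConfig d} {δ : DirConfig d}
    (h : OneInfinite ω δ) (h' : ¬TwoInfinite ω δ) : numInfiniteClusters ω δ = 1 := by
  have heq : ∀ v, ((blueGraph ω δ).connectedComponentMk v).supp = (blueGraph ω δ).comp v := by
    intro v
    ext w
    exact SimpleGraph.ConnectedComponent.eq.trans SimpleGraph.reachable_comm
  obtain ⟨x, hx⟩ := h
  rw [numInfiniteClusters, Set.encard_eq_one]
  refine ⟨(blueGraph ω δ).connectedComponentMk x, Set.eq_singleton_iff_unique_mem.2 ⟨?_, ?_⟩⟩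
  · rw [Set.mem_ofPred_eq, heq]
    exact hx
  · intro C
    induction C using SimpleGraph.ConnectedComponent.ind with
    | h v =>
      intro hC
      rw [Set.mem_ofPred_eq, heq] at hC
      refine SimpleGraph.ConnectedComponent.eq.2 ?_
      by_contra hn
      exact h' ⟨v, x, hC, hx, hn⟩

end OneChoice

theorem mainTheorem3 (d : ℕ) [NeZero d] (p : unitInterval) (hp : 0 < p) :
    (∀ᵐ x ∂(OneChoice.oneChoiceMeasure d p),
        OneChoice.numInfiniteClusters x.1 x.2 = 0) ∨
      (∀ᵐ x ∂(OneChoice.oneChoiceMeasure d p),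
        OneChoice.numInfiniteClusters x.1 x.2 = 1) := by
  have herg := (OneChoice.ergodic_shiftConfig (d := d) p
    (OneChoice.Direction.vec_ne_zero (0, true))).toPreErgodic
  rcases herg.ae_mem_or_ae_notMem (measurableSet_setOfPred.2 OneChoice.measurable_oneInfinite)
    (Set.ext fun c => OneChoice.oneInfinite_shift_iff c.1 c.2 _) with h | h
  · right
    filter_upwards [h, OneChoice.ae_not_twoInfinite p hp] with c hc hc'
    exact OneChoice.numInfiniteClusters_eq_one hc hc'
  · left
    filter_upwards [h] with c hc
    exact OneChoice.numInfiniteClusters_eq_zero hc
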